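/- There are universal constants $C,c_{\mathrm{HS}}>0$ with the following property. Let $N\ge 1$, $m\ge 0$, let $0<\epsilon\le\beta/2$, $\beta\le\alpha_O$, $0<\delta\le 1/2$. Then there are a number of samples $J$ and an estimation procedure $P$, depending only on $(N,m,\alpha_O,\beta,\epsilon,\delta)$, with $$J\le C\,\frac{\beta^2}{\epsilon^2}\log\frac1\delta ,\qquad \#\text{queries}(P)\le C\,\frac{\alpha_O}{\epsilon}\log\Big(\frac{\alpha_O}{\epsilon}\Big)\log\Big(\frac{\beta\log(1/\delta)}{\delta\,\epsilon}\Big),$$ such that the following holds for all data below. Here a procedure consists of finitely many independent runs of quantum circuits started in $|0\rangle$, each followed by a measurement in the computational basis, and of a classical function of the outcomes whose value is the estimate. The circuits consist of fixed unitaries and of (possibly controlled) queries to four black-box unitaries or their inverses; neither the circuits nor the classical function depend on the black boxes; and $\#\text{queries}(P)$ is the total number of queries in all runs. Data. Let $A:[0,T]\to\mathbb C^{N\times N}$ be continuous, $A=L+iH$ with $L=\frac{A+A^\dagger}{2}\succeq 0$ and $H=\frac{A-A^\dagger}{2i}$, and let $\|L(s)\|\le\Lambda$ on $[0,T]$ (spectral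 norm). Let $u'(s)=-A(s)u(s)$ on $[0,T]$, $u(0)=u_0$, and let $t\in[0,T]$. Let $O\in\mathbb C^{N\times N}$ be an observable with $\|O\|=\beta$ (that $O$ is Hermitian is not needed). Let $K\ge C\|O\|/\epsilon$ and let $M\ge C(1+\Lambda T)K^2$ be an integer; for $0\le j\le M$ put $k_j=-K+2jK/M$, $w_j=(2-\mathbf 1_{j\in\{0,M\}})K/M$, $c_j=\frac{w_j}{\pi(1+k_j^2)}$, and $U_j(t)=\mathcal T e^{-i\int_0^t(H(s)+k_jL(s))\,ds}$, i.e. $U_j'=-i(H+k_jL)U_j$, $U_j(0)=I$. The black boxes are a unitary $O_{\mathrm{prep}}$ with $O_{\mathrm{prep}}|0\rangle=u_0$; a unitary $U_O$ with $m$ ancilla qubits that is an $(\alpha_O,0)$-block-encoding of $O$, i.e. $(\langle 0|^{\otimes m}\otimes I)\,U_O\,(|0\rangle^{\otimes m}\otimes I)=O/\alpha_O$; and unitaries $\widetilde U_j$ with $\|\widetilde U_j-U_j(t)\|\le\epsilon_{\mathrm{HS}}:=c_{\mathrm{HS}}\,\epsilon/\|O\|$ for all $j$. Conclusion. (i) For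 every pair $(j,j')$, the procedure $P$ run with the black boxes $O_{\mathrm{prep}},U_O,\widetilde U_j,\widetilde U_{j'}$ outputs, with probability at least $1-\delta/J$, a number within $\epsilon$ of $u_0^*\,U_j(t)^\dagger\, O\, U_{j'}(t)\,u_0$. (ii) Draw $J$ independent samples, each consisting of a pair $(j,j')$ drawn with probability $c_jc_{j'}/\|c\|_1^2$ and the output $X$ of $P$ run with the black boxes $O_{\mathrm{prep}},U_O,\widetilde U_j,\widetilde U_{j'}$; let $\overline X$ be the mean of the $J$ outputs. Then $$\big|\,\|c\|_1^2\,\overline X-u(t)^*Ou(t)\,\big|\le\epsilon\quad\text{with probability at least }1-\delta .$$ -/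

import Mathlib

open scoped Matrix Kronecker Matrix.Norms.L2Operator ComplexOrder

noncomputable section

namespace LCHS

/-! ### The differential equation and its quadrature -/

/-- The Hermitian part `L = (A + A†) / 2`. -/
def hermPart {N : ℕ} (A : Matrix (Fin N) (Fin N) ℂ) : Matrix (Fin N) (Fin N) ℂ :=
  (1 / 2 : ℂ) • (A + Aᴴ)

/-- The matrix `H = (A - A†) / (2i)`, so that `A = L + iH`. -/
def antiHermPart {N : ℕ} (A : Matrix (Fin N) (Fin N) ℂ) : Matrix (Fin N) (Fin N) ℂ :=
  (1 / (2 * Complex.I)) • (A - Aᴴ)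

/-- `u` solves `u' = -A u` on `[0, T]`. -/
def IsSolution {N : ℕ} (T : ℝ) (A : ℝ → Matrix (Fin N) (Fin N) ℂ) (u : ℝ → Fin N → ℂ) : Prop :=
  ∀ s ∈ Set.Icc 0 T, HasDerivWithinAt u (-(A s *ᵥ u s)) (Set.Icc 0 T) s

/-- `V s` is the time-ordered exponential `𝒯 exp(-i ∫₀ˢ (H + k L))` for `s ∈ [0, T]`. -/
def IsPropagator {N : ℕ} (T : ℝ) (A : ℝ → Matrix (Fin N) (Fin N) ℂ) (k : ℝ)
    (V : ℝ → Matrix (Fin N) (Fin N) ℂ) : Prop :=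
  V 0 = 1 ∧ ∀ s ∈ Set.Icc 0 T, ∀ a b, HasDerivWithinAt (fun r => V r a b)
    ((-Complex.I • ((antiHermPart (A s) + (k : ℂ) • hermPart (A s)) * V s)) a b)
    (Set.Icc 0 T) s

/-- Nodes `k_j = -K + 2jK/M` of the trapezoidal rule on `[-K, K]`. -/
def node (K : ℝ) (M : ℕ) (j : Fin (M + 1)) : ℝ := -K + 2 * (j : ℕ) * K / M

/-- Weights of the trapezoidal rule on `[-K, K]`: `K/M` at the two ends, `2K/M` inside. -/
def weight (K : ℝ) (M : ℕ) (j : Fin (M + 1)) : ℝ :=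
  (2 - if (j : ℕ) = 0 ∨ (j : ℕ) = M then 1 else 0) * K / M

/-- The coefficients `c_j = w_j / (π (1 + k_j²))`. -/
def coeff (K : ℝ) (M : ℕ) (j : Fin (M + 1)) : ℝ :=
  weight K M j / (Real.pi * (1 + node K M j ^ 2))

/-- The norm `‖c‖₁`. -/
def coeffNorm (K : ℝ) (M : ℕ) : ℝ := ∑ j, |coeff K M j|

/-! ### Quantum circuits with oracle queries -/

/-- Computational basis of a register of `q` qubits; `fun _ => false` is `|0…0⟩`. -/
abbrev Qubits (q : ℕ) : Type := Fin q → Bool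

/-- Computational basis of the registers on which the oracles act: the `m` ancilla qubits of the
block encoding and the `N`-dimensional system. -/
abbrev OracleBasis (m N : ℕ) : Type := Qubits m × Fin N

/-- Computational basis of the whole machine, with `q` additional work qubits. -/
abbrev Basis (q m N : ℕ) : Type := Qubits q × OracleBasis m N

/-- The black boxes available to a circuit: the state preparation, the block encoding of the
observable, and the two evolutions of the sampled pair `(k, k')`. -/
inductive OracleName : Type
  | prep
  | obs
  | evol
  | evol'

/-- Unitaries for the black boxes. -/
structure Oracles (m N : ℕ) : Type where
  prep : Matrix.unitaryGroup (Fin N) ℂ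
  obs : Matrix.unitaryGroup (OracleBasis m N) ℂ
  evol : Matrix.unitaryGroup (Fin N) ℂ
  evol' : Matrix.unitaryGroup (Fin N) ℂ

/-- A black box as an operator on the block-encoding ancillas and the system. -/
def Oracles.op {m N : ℕ} (F : Oracles m N) :
    OracleName → Matrix (OracleBasis m N) (OracleBasis m N) ℂ
  | .prep => (1 : Matrix (Qubits m) (Qubits m) ℂ) ⊗ₖ (F.prep : Matrix (Fin N) (Fin N) ℂ)
  | .obs => (F.obs : Matrix (OracleBasis m N) (OracleBasis m N) ℂ)
  | .evol => (1 : Matrix (Qubits m) (Qubits m) ℂ) ⊗ₖ (F.evol : Matrix (Fin N) (Fin N) ℂ)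
  | .evol' => (1 : Matrix (Qubits m) (Qubits m) ℂ) ⊗ₖ (F.evol' : Matrix (Fin N) (Fin N) ℂ)

/-- A gate is either a fixed unitary, independent of the black boxes, or one query to a black box
or to its inverse (`inv = true`), possibly controlled by a work qubit. -/
inductive Gate (q m N : ℕ) : Type
  | free (V : Matrix.unitaryGroup (Basis q m N) ℂ)
  | query (o : OracleName) (inv : Bool) (ctrl : Option (Fin q))

/-- The unitary performed by a gate. -/
def Gate.mat {q m N : ℕ} (F : Oracles m N) :
    Gate q m N → Matrix (Basis q m N) (Basis q m N) ℂ
  | .free V => (V : Matrix (Basis q m N) (Basis q m N) ℂ)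
  | .query o inv ctrl => Matrix.of fun x y =>
      if x.1 = y.1 then
        if ∀ i ∈ ctrl, x.1 i = true then
          (if inv then (F.op o)ᴴ else F.op o) x.2 y.2
        else (1 : Matrix (OracleBasis m N) (OracleBasis m N) ℂ) x.2 y.2
      else 0

/-- The number of queries (0 or 1) made by a gate. -/
def Gate.cost {q m N : ℕ} : Gate q m N → ℕ
  | .free _ => 0
  | .query _ _ _ => 1

/-- The unitary performed by a circuit; the head of the list is applied first. -/
def circuitMat {q m N : ℕ} (F : Oracles m N) :
    List (Gate q m N) → Matrix (Basis q m N) (Basis q m N) ℂ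
  | [] => 1
  | g :: gs => circuitMat F gs * g.mat F

/-- Born's rule: the probability of observing `z` when the circuit is run on `|0⟩|0⟩|0⟩` and all
registers are measured in the computational basis. -/
def bornProb {q m N : ℕ} [NeZero N] (F : Oracles m N) (c : List (Gate q m N))
    (z : Basis q m N) : ℝ :=
  ‖circuitMat F c z (fun _ => false, fun _ => false, 0)‖ ^ 2

/-- A procedure for estimating a complex number with black boxes: finitely many independent runs
of fixed circuits, each followed by a measurement, and a classical function of the outcomes. The
circuits and the function do not depend on the black boxes. -/
structure Estimator (m N : ℕ) : Type where
  q : ℕ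
  runs : ℕ
  circuit : Fin runs → List (Gate q m N)
  post : (Fin runs → Basis q m N) → ℂ

/-- The measurement outcomes of all runs. -/
abbrev Estimator.Outcome {m N : ℕ} (P : Estimator m N) : Type := Fin P.runs → Basis P.q m N

/-- The total number of queries in all runs. -/
def Estimator.queries {m N : ℕ} (P : Estimator m N) : ℕ :=
  ∑ r, ((P.circuit r).map Gate.cost).sum

/-- The probability of a list of outcomes of the independent runs. -/
def Estimator.prob {m N : ℕ} [NeZero N] (P : Estimator m N) (F : Oracles m N)
    (z : P.Outcome) : ℝ :=
  ∏ r, bornProb F (P.circuit r) (z r)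

open Classical in
/-- The probability of an event under a weight function on a finite set. -/
def eventProb {S : Type} [Fintype S] (p : S → ℝ) (E : Set S) : ℝ :=
  ∑ x, if x ∈ E then p x else 0

/-! ### The Monte Carlo scheme -/

/-- The black boxes used for the pair `(k, k')`. -/
def pairOracles {m N M : ℕ} (prep : Matrix.unitaryGroup (Fin N) ℂ)
    (obs : Matrix.unitaryGroup (OracleBasis m N) ℂ)
    (W : Fin (M + 1) → Matrix.unitaryGroup (Fin N) ℂ) (k k' : Fin (M + 1)) : Oracles m N :=
  ⟨prep, obs, W k, W k'⟩

/-- One Monte Carlo sample: a pair `(k, k')` and the outcomes of the measurements for that pair. -/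
abbrev Sample {m N : ℕ} (P : Estimator m N) (M : ℕ) : Type :=
  (Fin (M + 1) × Fin (M + 1)) × P.Outcome

/-- The law of one sample: `(k, k')` is drawn with probability `c_k c_k' / ‖c‖₁²`, then the
procedure is run with the black boxes of that pair. -/
def sampleProb {m N : ℕ} [NeZero N] (P : Estimator m N) (K : ℝ) (M : ℕ)
    (prep : Matrix.unitaryGroup (Fin N) ℂ)
    (obs : Matrix.unitaryGroup (OracleBasis m N) ℂ)
    (W : Fin (M + 1) → Matrix.unitaryGroup (Fin N) ℂ) (x : Sample P M) : ℝ :=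
  coeff K M x.1.1 * coeff K M x.1.2 / coeffNorm K M ^ 2 *
    P.prob (pairOracles prep obs W x.1.1 x.1.2) x.2

/-- The law of `J` independent samples. -/
def samplesProb {m N : ℕ} [NeZero N] (P : Estimator m N) (K : ℝ) (M : ℕ)
    (prep : Matrix.unitaryGroup (Fin N) ℂ)
    (obs : Matrix.unitaryGroup (OracleBasis m N) ℂ)
    (W : Fin (M + 1) → Matrix.unitaryGroup (Fin N) ℂ) (J : ℕ) (ω : Fin J → Sample P M) : ℝ :=
  ∏ j, sampleProb P K M prep obs W (ω j)

/-- The output `‖c‖₁² X̄`, where `X̄` is the mean of the `J` single-sample estimates. -/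
def output {m N : ℕ} (P : Estimator m N) (K : ℝ) (M J : ℕ) (ω : Fin J → Sample P M) : ℂ :=
  (coeffNorm K M : ℂ) ^ 2 * ((∑ j, P.post (ω j).2) / (J : ℂ))

/-- `U` is an `(α, 0)`-block-encoding of `O` with `m` ancilla qubits:
`(⟨0| ⊗ I) U (|0⟩ ⊗ I) = O / α`. -/
def IsBlockEncoding {m N : ℕ} (α : ℝ) (O : Matrix (Fin N) (Fin N) ℂ)
    (U : Matrix.unitaryGroup (OracleBasis m N) ℂ) : Prop :=
  (U : Matrix (OracleBasis m N) (OracleBasis m N) ℂ).submatrix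
    (fun i => (fun _ => false, i)) (fun i => (fun _ => false, i)) = ((1 / α : ℝ) : ℂ) • O

end LCHS

end

noncomputable section

namespace LCHS

/-! Three independent facts carry the theorem.

Integral representation. Let `F κ` be the value at time `t` of the solution of `y' = -i(H + κL)y`,
`y 0 = u₀`. It is entire in `κ`, equals `u t` at `κ = -i`, and is bounded for `Im κ ≤ 0`, because
there `-i(H + κL)` is dissipative. Integrating `(F z - F (-i)) / (π(1 + z²))`, which has no pole in
the lower half plane, around a rectangle below `[-K, K]` shows that the Cauchy average of `F` over
`[-K, K]` is `F (-i)` up to `O(1/K)` (`norm_integral_cauchyKernel_smul_sub_le`). On the real axis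
`F` is Lipschitz with constant of order `Λt`, so the trapezoidal rule costs another `O(1/K)`. All of
this is proved for Euler iterates, which are polynomials in `κ`, and passes to the limit in the step
size; analytic dependence of differential equations on parameters is never needed
(`norm_sum_coeff_smul_sub_le`).

Amplitude estimation. With `V = O_prep† W† U_O W' O_prep`, the wanted number is `α⟨0|V|0⟩`. A
product of two reflections built from controlled `V` and `V†` returns to `|0⟩` after `k` steps with
probability `cos² kφ`, where `cos φ` is affine in the real or imaginary part of `⟨0|V|0⟩`.
Frequencies of constant accuracy for `k = 2^l` and `k = 2^l + 1`, `l ≤ L`, already determine `φ` up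
to `2^(-L)` (`angle_sub_le`). This costs `O(2^L)` queries times the number of shots, and the shots
enter only logarithmically through Hoeffding's inequality and a union bound (`estimatorPost_spec`).

Monte Carlo. With `x = ∑ cⱼ W̃ⱼ u₀` for the black-box evolutions `W̃ⱼ`, the expectation of the
sampled exact amplitudes is `⟨x, Ox⟩ / ‖c‖₁²`, and `x` is within a small multiple of `ε / ‖O‖` of `u
t`. Hoeffding's inequality controls the mean of the exact amplitudes, and a union bound replaces
these by the outputs of the procedure (`eventProb_mean_sub_le`). -/

/-! ### Finite probability -/

/-- `p` is a probability mass function on a finite set. -/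
structure IsProbWeight {S : Type} [Fintype S] (p : S → ℝ) : Prop where
  nonneg : ∀ x, 0 ≤ p x
  sum_eq_one : ∑ x, p x = 1

section Probability

variable {S : Type} [Fintype S] {p : S → ℝ}

theorem eventProb_mono (hp : IsProbWeight p) {E F : Set S} (h : E ⊆ F) :
    eventProb p E ≤ eventProb p F := by
  classical
  unfold eventProb
  refine Finset.sum_le_sum fun x _ => ?_
  by_cases hE : x ∈ E
  · simp [hE, h hE]
  · by_cases hF : x ∈ F <;> simp [hE, hF, hp.nonneg x]

theorem eventProb_compl (hp : IsProbWeight p) (E : Set S) :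
    eventProb p Eᶜ = 1 - eventProb p E := by
  classical
  unfold eventProb
  rw [← hp.sum_eq_one, ← Finset.sum_sub_distrib]
  refine Finset.sum_congr rfl fun x _ => ?_
  by_cases hE : x ∈ E <;> simp [hE]

theorem eventProb_union_le (hp : IsProbWeight p) (E F : Set S) :
    eventProb p (E ∪ F) ≤ eventProb p E + eventProb p F := by
  classical
  unfold eventProb
  rw [← Finset.sum_add_distrib]
  refine Finset.sum_le_sum fun x _ => ?_
  have := hp.nonneg x
  by_cases hE : x ∈ E <;> by_cases hF : x ∈ F <;> simp [hE, hF, this]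

theorem eventProb_iUnion_le (hp : IsProbWeight p) {ι : Type*} [Fintype ι] (E : ι → Set S) :
    eventProb p (⋃ i, E i) ≤ ∑ i, eventProb p (E i) := by
  classical
  unfold eventProb
  rw [Finset.sum_comm]
  refine Finset.sum_le_sum fun x _ => ?_
  have hnn : ∀ i, 0 ≤ (if x ∈ E i then p x else 0) := fun i => by
    split_ifs
    exacts [hp.nonneg x, le_rfl]
  by_cases hx : x ∈ ⋃ i, E i
  · obtain ⟨i, hi⟩ := Set.mem_iUnion.1 hx
    rw [if_pos hx]
    calc p x = (if x ∈ E i then p x else 0) := by rw [if_pos hi]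
      _ ≤ _ := Finset.single_le_sum (f := fun i => if x ∈ E i then p x else 0)
        (fun i _ => hnn i) (Finset.mem_univ i)
  · rw [if_neg hx]
    exact Finset.sum_nonneg fun i _ => hnn i

/-- Expectations of products of functions of independent variables factor. -/
theorem sum_prod_mul_prod {ι : Type} [Fintype ι] [DecidableEq ι] (p h : ι → S → ℝ) :
    ∑ ω : ι → S, (∏ i, p i (ω i)) * ∏ i, h i (ω i) = ∏ i, ∑ x, p i x * h i x := by
  classical
  rw [Finset.prod_univ_sum, Fintype.piFinset_univ]
  exact Finset.sum_congr rfl fun ω _ => Finset.prod_mul_distrib.symm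

theorem IsProbWeight.pi {ι : Type} [Fintype ι] [DecidableEq ι] {p : ι → S → ℝ}
    (hp : ∀ i, IsProbWeight (p i)) : IsProbWeight fun ω : ι → S => ∏ i, p i (ω i) where
  nonneg ω := Finset.prod_nonneg fun i _ => (hp i).nonneg _
  sum_eq_one := by
    have := sum_prod_mul_prod p fun _ _ => 1
    simpa [(hp _).sum_eq_one] using this

theorem eventProb_pi_eval {ι : Type} [Fintype ι] [DecidableEq ι] {p : ι → S → ℝ}
    (hp : ∀ i, IsProbWeight (p i)) (i : ι) (E : Set S) :
    eventProb (fun ω : ι → S => ∏ i, p i (ω i)) {ω | ω i ∈ E} = eventProb (p i) E := by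
  classical
  -- The indicator of `E` in coordinate `i` and the constant one elsewhere: the other factors
  -- integrate to one.
  have := sum_prod_mul_prod p fun j x => if j = i then (if x ∈ E then 1 else 0) else 1
  unfold eventProb
  rw [Finset.prod_eq_single i] at this
  · simpa [Finset.prod_ite_eq'] using this
  · intro j _ hj
    simp [hj, (hp j).sum_eq_one]
  · simp

/-- Hoeffding's lemma. By convexity `exp` lies below its chord on `[-b, b]`; the linear part of the
chord has mean zero, and `cosh b ≤ exp (b² / 2)`. -/
theorem sum_mul_exp_le (hp : IsProbWeight p) {X : S → ℝ} {b : ℝ} (hb : 0 < b)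
    (hX : ∀ x, |X x| ≤ b) (hmean : ∑ x, p x * X x = 0) :
    ∑ x, p x * Real.exp (X x) ≤ Real.exp (b ^ 2 / 2) := by
  refine le_trans ?_ (Real.cosh_le_exp_half_sq b)
  have key : ∀ x, Real.exp (X x) ≤ Real.cosh b + X x / b * Real.sinh b := fun x => by
    have h := Real.exp_mul_le_cosh_add_mul_sinh (t := X x / b)
      (by rw [abs_div, abs_of_pos hb, div_le_one hb]; exact hX x) b
    rwa [div_mul_cancel₀ _ hb.ne'] at h
  calc ∑ x, p x * Real.exp (X x)
      ≤ ∑ x, p x * (Real.cosh b + X x / b * Real.sinh b) :=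
        Finset.sum_le_sum fun x _ => mul_le_mul_of_nonneg_left (key x) (hp.nonneg x)
    _ = ∑ x, (p x * Real.cosh b + p x * X x * (Real.sinh b / b)) :=
        Finset.sum_congr rfl fun x _ => by ring
    _ = Real.cosh b := by
        rw [Finset.sum_add_distrib, ← Finset.sum_mul, ← Finset.sum_mul, hp.sum_eq_one, hmean]
        ring

/-- One-sided Hoeffding bound for the variables `X i` with `i` in a subset `A`. -/
theorem eventProb_sum_ge_le {ι : Type} [Fintype ι] [DecidableEq ι] {p : ι → S → ℝ}
    (hp : ∀ i, IsProbWeight (p i)) (A : Finset ι) {X : ι → S → ℝ} {b τ : ℝ} (hb : 0 < b)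
    (hτ : 0 < τ) (hX : ∀ i ∈ A, ∀ x, |X i x| ≤ b) (hmean : ∀ i ∈ A, ∑ x, p i x * X i x = 0) :
    eventProb (fun ω : ι → S => ∏ i, p i (ω i)) {ω | A.card * τ ≤ ∑ i ∈ A, X i (ω i)} ≤
      Real.exp (-(A.card * τ ^ 2 / (2 * b ^ 2))) := by
  classical
  -- The Chernoff parameter that minimizes `l² b² / 2 - l τ`.
  set l : ℝ := τ / b ^ 2 with hl
  have hl0 : 0 < l := by positivity
  -- Coordinates outside `A` get the factor one, so they drop out of the moment generating function.
  have hmgf := sum_prod_mul_prod p fun i x => if i ∈ A then Real.exp (l * X i x) else 1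
  have hle : ∏ i, ∑ x, p i x * (if i ∈ A then Real.exp (l * X i x) else 1) ≤
      Real.exp (A.card * ((l * b) ^ 2 / 2)) := by
    rw [Real.exp_nat_mul, ← Finset.prod_const, ← Finset.prod_subset (Finset.subset_univ A)]
    · refine Finset.prod_le_prod (fun i _ => Finset.sum_nonneg fun x _ =>
        mul_nonneg ((hp i).nonneg x) (by split_ifs; all_goals positivity)) fun i hi => ?_
      simp only [hi, if_true]
      refine sum_mul_exp_le (hp i) (by positivity) (fun x => ?_) ?_
      · rw [abs_mul, abs_of_pos hl0]
        exact mul_le_mul_of_nonneg_left (hX i hi x) hl0.le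
      · rw [← mul_zero l, ← hmean i hi, Finset.mul_sum]
        exact Finset.sum_congr rfl fun x _ => by ring
    · intro i _ hi
      simp [hi, (hp i).sum_eq_one]
  have hprod : ∀ ω : ι → S, ∏ i, (if i ∈ A then Real.exp (l * X i (ω i)) else 1) =
      Real.exp (l * ∑ i ∈ A, X i (ω i)) := fun ω => by
    rw [Finset.prod_ite_mem, Finset.univ_inter, ← Real.exp_sum, Finset.mul_sum]
  simp only [hprod] at hmgf
  calc eventProb (fun ω : ι → S => ∏ i, p i (ω i)) {ω | A.card * τ ≤ ∑ i ∈ A, X i (ω i)}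
      ≤ ∑ ω : ι → S, Real.exp (-(l * (A.card * τ))) *
          ((∏ i, p i (ω i)) * Real.exp (l * ∑ i ∈ A, X i (ω i))) := by
        unfold eventProb
        refine Finset.sum_le_sum fun ω _ => ?_
        have h0 : 0 ≤ ∏ i, p i (ω i) := (IsProbWeight.pi hp).nonneg ω
        split_ifs with h
        -- Markov's inequality, pointwise: on the event this exponential dominates the indicator.
        · have h1 : 1 ≤ Real.exp (-(l * (A.card * τ))) * Real.exp (l * ∑ i ∈ A, X i (ω i)) := by
            rw [← Real.exp_add]
            refine Real.one_le_exp ?_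
            have := mul_le_mul_of_nonneg_left h hl0.le
            linarith
          calc ∏ i, p i (ω i) = (∏ i, p i (ω i)) * 1 := (mul_one _).symm
            _ ≤ (∏ i, p i (ω i)) * _ := mul_le_mul_of_nonneg_left h1 h0
            _ = _ := by ring
        · positivity
    _ ≤ Real.exp (-(l * (A.card * τ))) * Real.exp (A.card * ((l * b) ^ 2 / 2)) := by
        rw [← Finset.mul_sum, hmgf]
        exact mul_le_mul_of_nonneg_left hle (Real.exp_pos _).le
    _ = Real.exp (-(A.card * τ ^ 2 / (2 * b ^ 2))) := by
        rw [← Real.exp_add, hl]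
        congr 1
        field_simp
        ring

/-- Two-sided Hoeffding bound for the variables `X i` with `i` in a subset `A`. -/
theorem eventProb_abs_sum_ge_le {ι : Type} [Fintype ι] [DecidableEq ι] {p : ι → S → ℝ}
    (hp : ∀ i, IsProbWeight (p i)) (A : Finset ι) {X : ι → S → ℝ} {b τ : ℝ} (hb : 0 < b)
    (hτ : 0 < τ) (hX : ∀ i ∈ A, ∀ x, |X i x| ≤ b) (hmean : ∀ i ∈ A, ∑ x, p i x * X i x = 0) :
    eventProb (fun ω : ι → S => ∏ i, p i (ω i)) {ω | A.card * τ ≤ |∑ i ∈ A, X i (ω i)|} ≤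
      2 * Real.exp (-(A.card * τ ^ 2 / (2 * b ^ 2))) := by
  have h1 := eventProb_sum_ge_le hp A hb hτ hX hmean
  have h2 := eventProb_sum_ge_le hp A (X := fun i x => -X i x) hb hτ
    (fun i hi x => by simpa using hX i hi x)
    (fun i hi => by simpa using hmean i hi)
  refine (eventProb_mono (IsProbWeight.pi hp) ?_).trans
    ((eventProb_union_le (IsProbWeight.pi hp) _ _).trans ((add_le_add h1 h2).trans_eq (by ring)))
  intro ω hω
  simp only [Set.mem_ofPred_eq, Set.mem_union, Finset.sum_neg_distrib] at hω ⊢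
  exact le_abs.1 hω

end Probability

/-! ### Circuits are unitary -/

/-- The operator that applies `Z x` to the oracle registers when the work qubits are in state `x`. -/
def workDiag {q m N : ℕ} (Z : Qubits q → Matrix (OracleBasis m N) (OracleBasis m N) ℂ) :
    Matrix (Basis q m N) (Basis q m N) ℂ :=
  Matrix.of fun x y => if x.1 = y.1 then Z x.1 x.2 y.2 else 0

theorem workDiag_mul {q m N : ℕ}
    (Y Z : Qubits q → Matrix (OracleBasis m N) (OracleBasis m N) ℂ) :
    workDiag Y * workDiag Z = workDiag fun x => Y x * Z x := by
  ext ⟨x, a⟩ ⟨y, b⟩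
  simp only [workDiag, Matrix.mul_apply, Matrix.of_apply, Fintype.sum_prod_type]
  rw [Finset.sum_eq_single x]
  · by_cases h : x = y <;> simp [h]
  · intro z _ hz
    simp [Ne.symm hz]
  · simp

theorem workDiag_conjTranspose {q m N : ℕ}
    (Z : Qubits q → Matrix (OracleBasis m N) (OracleBasis m N) ℂ) :
    (workDiag Z)ᴴ = workDiag fun x => (Z x)ᴴ := by
  ext ⟨x, a⟩ ⟨y, b⟩
  by_cases h : x = y
  · simp [workDiag, Matrix.conjTranspose_apply, h]
  · simp [workDiag, Matrix.conjTranspose_apply, h, Ne.symm h]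

theorem workDiag_one {q m N : ℕ} :
    workDiag (fun _ => 1 : Qubits q → Matrix (OracleBasis m N) (OracleBasis m N) ℂ) = 1 := by
  ext ⟨x, a⟩ ⟨y, b⟩
  by_cases h : x = y <;> by_cases h' : a = b <;> simp [workDiag, Matrix.one_apply, h, h']

theorem workDiag_mem_unitaryGroup {q m N : ℕ}
    {Z : Qubits q → Matrix (OracleBasis m N) (OracleBasis m N) ℂ}
    (h : ∀ x, Z x ∈ Matrix.unitaryGroup (OracleBasis m N) ℂ) :
    workDiag Z ∈ Matrix.unitaryGroup (Basis q m N) ℂ := by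
  rw [Matrix.mem_unitaryGroup_iff, Matrix.star_eq_conjTranspose, workDiag_conjTranspose,
    workDiag_mul, ← workDiag_one]
  congr 1
  funext x
  exact Matrix.mem_unitaryGroup_iff.1 (h x)

theorem Oracles.op_mem_unitaryGroup {m N : ℕ} (F : Oracles m N) (o : OracleName) :
    F.op o ∈ Matrix.unitaryGroup (OracleBasis m N) ℂ := by
  cases o
  · exact Matrix.kronecker_mem_unitary (one_mem _) F.prep.2
  · exact F.obs.2
  · exact Matrix.kronecker_mem_unitary (one_mem _) F.evol.2
  · exact Matrix.kronecker_mem_unitary (one_mem _) F.evol'.2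

theorem Gate.mat_mem_unitaryGroup {q m N : ℕ} (F : Oracles m N) (g : Gate q m N) :
    g.mat F ∈ Matrix.unitaryGroup (Basis q m N) ℂ := by
  cases g with
  | free V => exact V.2
  | query o inv ctrl =>
    -- A query is block diagonal over the states of the work qubits, with a unitary in each block.
    have : (Gate.query o inv ctrl).mat F = workDiag fun x : Qubits q =>
        if ∀ i ∈ ctrl, x i = true then (if inv then (F.op o)ᴴ else F.op o) else 1 := by
      ext x y
      simp only [Gate.mat, workDiag, Matrix.of_apply]
      split_ifs <;> rfl
    rw [this]
    refine workDiag_mem_unitaryGroup fun x => ?_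
    split_ifs
    · exact Unitary.star_mem (F.op_mem_unitaryGroup o)
    · exact F.op_mem_unitaryGroup o
    · exact one_mem _

theorem circuitMat_mem_unitaryGroup {q m N : ℕ} (F : Oracles m N) (c : List (Gate q m N)) :
    circuitMat F c ∈ Matrix.unitaryGroup (Basis q m N) ℂ := by
  induction c with
  | nil => exact one_mem _
  | cons g gs ih => exact mul_mem ih (g.mat_mem_unitaryGroup F)

theorem circuitMat_append {q m N : ℕ} (F : Oracles m N) (c d : List (Gate q m N)) :
    circuitMat F (c ++ d) = circuitMat F d * circuitMat F c := by
  induction c with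
  | nil => simp [circuitMat]
  | cons g gs ih => simp [circuitMat, ih, mul_assoc]

theorem circuitMat_flatten_replicate {q m N : ℕ} (F : Oracles m N) (c : List (Gate q m N))
    (k : ℕ) : circuitMat F (List.replicate k c).flatten = circuitMat F c ^ k := by
  induction k with
  | zero => simp [circuitMat]
  | succ k ih => rw [List.replicate_succ, List.flatten_cons, circuitMat_append, ih, pow_succ]

/-- The column of a unitary matrix that belongs to the initial state has norm one. -/
theorem bornProb_isProbWeight {q m N : ℕ} [NeZero N] (F : Oracles m N) (c : List (Gate q m N)) :
    IsProbWeight (bornProb F c) where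
  nonneg z := sq_nonneg _
  sum_eq_one := by
    have h := Matrix.mem_unitaryGroup_iff'.1 (circuitMat_mem_unitaryGroup F c)
    have h0 := congrFun (congrFun h (fun _ => false, fun _ => false, 0))
      (fun _ => false, fun _ => false, 0)
    rw [Matrix.mul_apply, Matrix.one_apply_eq] at h0
    have h1 := congrArg Complex.re h0
    rw [Complex.re_sum, Complex.one_re] at h1
    rw [← h1]
    refine Finset.sum_congr rfl fun z _ => ?_
    rw [bornProb, Matrix.star_apply, RCLike.star_def, ← Complex.normSq_eq_conj_mul_self,
      Complex.ofReal_re, Complex.normSq_eq_norm_sq]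

theorem Estimator.prob_isProbWeight {m N : ℕ} [NeZero N] (P : Estimator m N) (F : Oracles m N) :
    IsProbWeight (P.prob F) :=
  IsProbWeight.pi fun r => bornProb_isProbWeight F (P.circuit r)

/-! ### Products of two reflections -/

/-- If `B` is an involution with `⟨0|B|0⟩ = cos φ` and `R` is the reflection about `|0⟩`, then
`⟨0|(RB)ᵏ|0⟩ = cos kφ`. -/
theorem reflection_mul_pow_apply {ι : Type*} [Fintype ι] [DecidableEq ι] (B : Matrix ι ι ℂ)
    (i : ι) {φ : ℝ} (hB : B * B = 1) (hφ : B i i = Real.cos φ) (hs : Real.sin φ ≠ 0) (k : ℕ) :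
    (((Matrix.diagonal (fun z => if z = i then 1 else -1) : Matrix ι ι ℂ) * B) ^ k) i i =
      Real.cos (k * φ) := by
  set R : Matrix ι ι ℂ := Matrix.diagonal fun z => if z = i then 1 else -1 with hR
  set e : ι → ℂ := Pi.single i 1 with he
  have hRv : ∀ v : ι → ℂ, R *ᵥ v = (2 * v i) • e - v := by
    intro v
    funext z
    rw [hR, Matrix.mulVec_diagonal]
    by_cases hz : z = i
    · subst hz
      simp [he]
      ring
    · simp [he, hz]
  have hBe : (B *ᵥ e) i = Real.cos φ := by
    rw [he, Matrix.mulVec_single_one, ← hφ]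
    rfl
  have hGe : (R * B) *ᵥ e = (2 * (Real.cos φ : ℂ)) • e - B *ᵥ e := by
    rw [← Matrix.mulVec_mulVec, hRv, hBe]
  have hGBe : (R * B) *ᵥ (B *ᵥ e) = e := by
    rw [Matrix.mulVec_mulVec, mul_assoc, hB, mul_one, hRv]
    funext z
    simp [he]
    ring
  -- The span of `e` and `B e` is invariant under `R B`, which maps `e` to `2 cos φ • e - B e` and
  -- `B e` to `e`. This is the recurrence of the Chebyshev polynomials `sin ((k+1)φ) / sin φ`; the
  -- factor `sin φ` stays on the left to avoid division.
  have hpow : ∀ k : ℕ, (Real.sin φ : ℂ) • ((R * B) ^ k *ᵥ e) =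
      (Real.sin ((k + 1) * φ) : ℂ) • e - (Real.sin (k * φ) : ℂ) • (B *ᵥ e) := by
    intro k
    induction k with
    | zero => simp
    | succ k ih =>
      rw [pow_succ', ← Matrix.mulVec_mulVec, ← Matrix.mulVec_smul, ih, Matrix.mulVec_sub,
        Matrix.mulVec_smul, Matrix.mulVec_smul, hGe, hGBe]
      have h1 : Real.sin (((k + 1 : ℕ) + 1) * φ) =
          2 * Real.cos φ * Real.sin ((k + 1) * φ) - Real.sin (k * φ) := by
        have e1 : (((k + 1 : ℕ) : ℝ) + 1) * φ = (k + 1) * φ + φ := by push_cast; ring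
        have e2 : (k : ℝ) * φ = (k + 1) * φ - φ := by ring
        rw [e1, e2, Real.sin_add, Real.sin_sub]
        ring
      rw [h1]
      push_cast
      funext z
      simp only [Pi.sub_apply, Pi.smul_apply, smul_eq_mul]
      ring
  have h := congrFun (hpow k) i
  have h2 : ((R * B) ^ k *ᵥ e) i = ((R * B) ^ k) i i := by
    rw [he, Matrix.mulVec_single_one]
    rfl
  simp only [Pi.sub_apply, Pi.smul_apply, smul_eq_mul, h2, hBe] at h
  have h3 : e i = 1 := by simp [he]
  rw [h3] at h
  have h4 : Real.sin ((k + 1) * φ) = Real.sin (k * φ) * Real.cos φ +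
      Real.cos (k * φ) * Real.sin φ := by
    rw [add_mul, one_mul, Real.sin_add]
  rw [h4] at h
  have hs' : (Real.sin φ : ℂ) ≠ 0 := by exact_mod_cast hs
  apply mul_left_cancel₀ hs'
  rw [h]
  push_cast
  ring

/-! ### The amplitude estimation circuit -/

/-- A single-qubit operator as an operator on a register of one qubit. -/
def qubitMat (X : Matrix Bool Bool ℂ) : Matrix (Qubits 1) (Qubits 1) ℂ :=
  X.submatrix (Equiv.funUnique (Fin 1) Bool) (Equiv.funUnique (Fin 1) Bool)

theorem qubitMat_mul (X Y : Matrix Bool Bool ℂ) : qubitMat X * qubitMat Y = qubitMat (X * Y) :=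
  Matrix.submatrix_mul_equiv _ _ _ _ _

theorem qubitMat_one : qubitMat 1 = 1 :=
  Matrix.submatrix_one_equiv _

/-- The reflection `[[p, r], [r̄, -p]]` of a qubit. -/
def qubitReflection (p : ℝ) (r : ℂ) : Matrix Bool Bool ℂ :=
  Matrix.of fun x y => bif x then (bif y then -(p : ℂ) else star r) else (bif y then r else p)

theorem qubitReflection_mul_self {p : ℝ} {r : ℂ} (h : p ^ 2 + ‖r‖ ^ 2 = 1) :
    qubitReflection p r * qubitReflection p r = 1 := by
  have h1 : (p : ℂ) * p + r * star r = 1 := by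
    rw [RCLike.star_def, Complex.mul_conj, Complex.normSq_eq_norm_sq]
    exact_mod_cast (by rw [← h]; ring : p * p + ‖r‖ ^ 2 = 1)
  rw [RCLike.star_def] at h1
  ext x y
  cases x <;> cases y <;> simp [qubitReflection, Matrix.mul_apply] <;>
    first | linear_combination h1 | ring

theorem qubitReflection_star (p : ℝ) (r : ℂ) :
    (qubitReflection p r)ᴴ = qubitReflection p r := by
  ext x y
  cases x <;> cases y <;> simp [qubitReflection, Matrix.conjTranspose_apply]

theorem qubitReflection_kronecker_mul_self {m N : ℕ} {p : ℝ} {r : ℂ} (h : p ^ 2 + ‖r‖ ^ 2 = 1) :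
    (qubitMat (qubitReflection p r) ⊗ₖ (1 : Matrix (OracleBasis m N) (OracleBasis m N) ℂ)) *
      (qubitMat (qubitReflection p r) ⊗ₖ (1 : Matrix (OracleBasis m N) (OracleBasis m N) ℂ)) =
      1 := by
  rw [← Matrix.mul_kronecker_mul, qubitMat_mul, qubitReflection_mul_self h, qubitMat_one, mul_one,
    Matrix.one_kronecker_one]

/-- The reflection of the work qubit as a gate. -/
def reflectionGate {m N : ℕ} (p : ℝ) (r : ℂ) (h : p ^ 2 + ‖r‖ ^ 2 = 1) :
    Matrix.unitaryGroup (Basis 1 m N) ℂ :=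
  ⟨qubitMat (qubitReflection p r) ⊗ₖ 1, by
    rw [Matrix.mem_unitaryGroup_iff, Matrix.star_eq_conjTranspose, Matrix.conjTranspose_kronecker,
      Matrix.conjTranspose_one, qubitMat, Matrix.conjTranspose_submatrix, qubitReflection_star]
    exact qubitReflection_kronecker_mul_self h⟩

/-- The reflection about the initial state. -/
def zeroReflection {q m N : ℕ} [NeZero N] : Matrix.unitaryGroup (Basis q m N) ℂ :=
  ⟨Matrix.diagonal fun z => if z = (fun _ => false, fun _ => false, 0) then 1 else -1, by
    rw [Matrix.mem_unitaryGroup_iff, Matrix.star_eq_conjTranspose, Matrix.diagonal_conjTranspose,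
      Matrix.diagonal_mul_diagonal, ← Matrix.diagonal_one]
    congr 1
    funext z
    by_cases h : z = (fun _ => false, fun _ => false, 0) <;> simp [h]⟩

/-- `X` controlled by the work qubit. -/
def controlled {m N : ℕ} (X : Matrix (OracleBasis m N) (OracleBasis m N) ℂ) :
    Matrix (Basis 1 m N) (Basis 1 m N) ℂ :=
  qubitMat (Matrix.single false false 1) ⊗ₖ 1 + qubitMat (Matrix.single true true 1) ⊗ₖ X

theorem controlled_mul {m N : ℕ} (X Y : Matrix (OracleBasis m N) (OracleBasis m N) ℂ) :
    controlled X * controlled Y = controlled (X * Y) := by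
  simp only [controlled, mul_add, add_mul, ← Matrix.mul_kronecker_mul, qubitMat_mul, mul_one,
    one_mul]
  simp [qubitMat]

theorem controlled_one {m N : ℕ} :
    controlled (1 : Matrix (OracleBasis m N) (OracleBasis m N) ℂ) = 1 := by
  have : Matrix.single false false (1 : ℂ) + Matrix.single true true 1 = 1 := by
    ext x y
    cases x <;> cases y <;> simp
  rw [controlled, ← Matrix.add_kronecker]
  exact (congrArg (fun X => qubitMat X ⊗ₖ 1) this).trans
    (by rw [qubitMat_one, Matrix.one_kronecker_one])

theorem Gate.mat_query_controlled {m N : ℕ} (F : Oracles m N) (o : OracleName) (inv : Bool) :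
    (Gate.query o inv (some (0 : Fin 1))).mat F =
      controlled (if inv then (F.op o)ᴴ else F.op o) := by
  ext ⟨x, a⟩ ⟨y, b⟩
  have hxy : x = y ↔ x 0 = y 0 := by
    rw [funext_iff, Fin.forall_fin_one]
  simp only [Gate.mat, controlled, Matrix.of_apply, Matrix.add_apply, Matrix.kroneckerMap_apply,
    qubitMat, Matrix.submatrix_apply, Equiv.funUnique_apply, hxy, Option.mem_def,
    Option.some.injEq, forall_eq', Fin.default_eq_zero]
  cases x 0 <;> cases y 0 <;> simp

/-- The operator `O_prep† W† U_O W' O_prep` on the oracle registers. -/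
def overlapOp {m N : ℕ} (F : Oracles m N) : Matrix (OracleBasis m N) (OracleBasis m N) ℂ :=
  (F.op .prep)ᴴ * ((F.op .evol)ᴴ * (F.op .obs * (F.op .evol' * F.op .prep)))

/-- The controlled application of `overlapOp`. -/
def overlapCircuit (m N : ℕ) : List (Gate 1 m N) :=
  [.query .prep false (some 0), .query .evol' false (some 0), .query .obs false (some 0),
    .query .evol true (some 0), .query .prep true (some 0)]

/-- The inverse of `overlapCircuit`. -/
def overlapCircuitInv (m N : ℕ) : List (Gate 1 m N) :=
  [.query .prep false (some 0), .query .evol false (some 0), .query .obs true (some 0),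
    .query .evol' true (some 0), .query .prep true (some 0)]

theorem circuitMat_overlapCircuit {m N : ℕ} (F : Oracles m N) :
    circuitMat F (overlapCircuit m N) = controlled (overlapOp F) := by
  simp [circuitMat, overlapCircuit, Gate.mat_query_controlled, controlled_mul, overlapOp, mul_assoc]

theorem circuitMat_overlapCircuitInv {m N : ℕ} (F : Oracles m N) :
    circuitMat F (overlapCircuitInv m N) = controlled (overlapOp F)ᴴ := by
  simp [circuitMat, overlapCircuitInv, Gate.mat_query_controlled, controlled_mul, overlapOp,
    mul_assoc]

theorem overlapOp_mem_unitaryGroup {m N : ℕ} (F : Oracles m N) :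
    overlapOp F ∈ Matrix.unitaryGroup (OracleBasis m N) ℂ :=
  mul_mem (Unitary.star_mem (F.op_mem_unitaryGroup _)) <|
    mul_mem (Unitary.star_mem (F.op_mem_unitaryGroup _)) <|
      mul_mem (F.op_mem_unitaryGroup _) <|
        mul_mem (F.op_mem_unitaryGroup _) (F.op_mem_unitaryGroup _)

/-- The triple 5, 12, 13 gives rational amplitudes, and with them `shiftedCos` keeps the estimated
angle away from `0` and `π / 2`. -/
theorem norm_phase_eq {r : ℂ} (hr : ‖r‖ = 1) : (12 / 13 : ℝ) ^ 2 + ‖5 / 13 * r‖ ^ 2 = 1 := by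
  rw [norm_mul, hr]
  norm_num

/-- An involution whose expectation in the initial state is affine in `Re (r ⟨0|V|0⟩)`, where `V`
is `overlapOp`. -/
def overlapReflection {m N : ℕ} (F : Oracles m N) (r : ℂ) :
    Matrix (Basis 1 m N) (Basis 1 m N) ℂ :=
  (qubitMat (qubitReflection (12 / 13) (5 / 13 * 1)) ⊗ₖ 1) * controlled (overlapOp F)ᴴ *
    (qubitMat (qubitReflection (12 / 13) (5 / 13 * r)) ⊗ₖ 1) * controlled (overlapOp F) *
      (qubitMat (qubitReflection (12 / 13) (5 / 13 * 1)) ⊗ₖ 1)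

/-- The product is a palindrome `Q C⁻¹ S C Q` with involutions `Q` and `S`, so its square cancels
from the middle outwards. -/
theorem overlapReflection_mul_self {m N : ℕ} (F : Oracles m N) {r : ℂ} (hr : ‖r‖ = 1) :
    overlapReflection F r * overlapReflection F r = 1 := by
  have hQ := qubitReflection_kronecker_mul_self (m := m) (N := N) (norm_phase_eq norm_one)
  have hS := qubitReflection_kronecker_mul_self (m := m) (N := N) (norm_phase_eq hr)
  have hC : controlled (overlapOp F)ᴴ * controlled (overlapOp F) = 1 := by
    rw [controlled_mul]
    exact (congrArg _ (Matrix.mem_unitaryGroup_iff'.1 (overlapOp_mem_unitaryGroup F))).trans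
      controlled_one
  have hC' : controlled (overlapOp F) * controlled (overlapOp F)ᴴ = 1 := by
    rw [controlled_mul]
    exact (congrArg _ (Matrix.mem_unitaryGroup_iff.1 (overlapOp_mem_unitaryGroup F))).trans
      controlled_one
  unfold overlapReflection
  generalize qubitMat (qubitReflection (12 / 13) (5 / 13 * 1)) ⊗ₖ
    (1 : Matrix (OracleBasis m N) (OracleBasis m N) ℂ) = Q at *
  generalize qubitMat (qubitReflection (12 / 13) (5 / 13 * r)) ⊗ₖ
    (1 : Matrix (OracleBasis m N) (OracleBasis m N) ℂ) = S at *
  generalize controlled (overlapOp F) = C at *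
  generalize controlled (overlapOp F)ᴴ = D at *
  calc Q * D * S * C * Q * (Q * D * S * C * Q) = Q * D * S * C * (Q * Q) * D * S * C * Q := by
        noncomm_ring
    _ = Q * D * S * (C * D) * S * C * Q := by rw [hQ]; noncomm_ring
    _ = Q * D * (S * S) * C * Q := by rw [hC']; noncomm_ring
    _ = Q * (D * C) * Q := by rw [hS]; noncomm_ring
    _ = 1 := by rw [hC, mul_one, hQ]

/-- The affine map from the wanted number to the cosine of the estimated angle. -/
def shiftedCos (x : ℝ) : ℝ := (1428 + 600 * x) / 2197

/-- Expanding both controlled operators over the work qubit leaves four terms. The two diagonal ones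
contain `1` or `V†V = 1` and give `(12³ - 12·5²) / 13³`; the two mixed ones contain `V` and `V†` and
add up to `2·12·5² / 13³` times `Re (r⟨0|V|0⟩)`. -/
theorem overlapReflection_apply_zero {m N : ℕ} [NeZero N] (F : Oracles m N) (r : ℂ) :
    overlapReflection F r (fun _ => false, fun _ => false, 0) (fun _ => false, fun _ => false, 0) =
      shiftedCos (r * overlapOp F (fun _ => false, 0) (fun _ => false, 0)).re := by
  have hV : (overlapOp F)ᴴ * overlapOp F = 1 :=
    Matrix.mem_unitaryGroup_iff'.1 (overlapOp_mem_unitaryGroup F)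
  have key : ∀ X Y Z : Matrix Bool Bool ℂ,
      (qubitMat X ⊗ₖ 1) * controlled (overlapOp F)ᴴ * (qubitMat Y ⊗ₖ 1) *
        controlled (overlapOp F) * (qubitMat Z ⊗ₖ 1) =
      qubitMat (X * Matrix.single false false 1 * Y * Matrix.single false false 1 * Z) ⊗ₖ 1 +
      qubitMat (X * Matrix.single true true 1 * Y * Matrix.single true true 1 * Z) ⊗ₖ 1 +
      qubitMat (X * Matrix.single false false 1 * Y * Matrix.single true true 1 * Z) ⊗ₖ
        overlapOp F +
      qubitMat (X * Matrix.single true true 1 * Y * Matrix.single false false 1 * Z) ⊗ₖ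
        (overlapOp F)ᴴ := by
    intro X Y Z
    simp only [controlled, mul_add, add_mul, ← Matrix.mul_kronecker_mul, qubitMat_mul, mul_one,
      one_mul, hV]
    abel
  rw [overlapReflection, key]
  simp only [Matrix.add_apply, Matrix.kroneckerMap_apply, qubitMat, Matrix.submatrix_apply,
    Equiv.funUnique_apply, Matrix.one_apply_eq, Matrix.conjTranspose_apply]
  generalize overlapOp F (fun _ => false, 0) (fun _ => false, 0) = a
  simp only [Matrix.mul_apply, Fintype.sum_bool, qubitReflection, Matrix.of_apply, cond_true,
    cond_false]
  apply Complex.ext <;> simp [shiftedCos] <;> ring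

/-- One step of amplitude amplification for `Re (r ⟨0|V|0⟩)`. -/
def amplifyStep (m N : ℕ) [NeZero N] (r : ℂ) (hr : ‖r‖ = 1) : List (Gate 1 m N) :=
  [.free (reflectionGate (12 / 13) (5 / 13 * 1) (norm_phase_eq norm_one))] ++
    overlapCircuit m N ++ [.free (reflectionGate (12 / 13) (5 / 13 * r) (norm_phase_eq hr))] ++
      overlapCircuitInv m N ++
        [.free (reflectionGate (12 / 13) (5 / 13 * 1) (norm_phase_eq norm_one)),
          .free zeroReflection]

theorem circuitMat_amplifyStep {m N : ℕ} [NeZero N] (F : Oracles m N) {r : ℂ} (hr : ‖r‖ = 1) :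
    circuitMat F (amplifyStep m N r hr) =
      Matrix.diagonal (fun z => if z = (fun _ => false, fun _ => false, 0) then 1 else -1) *
        overlapReflection F r := by
  simp only [amplifyStep, circuitMat_append, circuitMat_overlapCircuit,
    circuitMat_overlapCircuitInv, circuitMat, one_mul, Gate.mat, zeroReflection, reflectionGate,
    overlapReflection, mul_assoc]

/-- `k` steps of amplitude amplification. -/
def amplifyCircuit (m N : ℕ) [NeZero N] (r : ℂ) (hr : ‖r‖ = 1) (k : ℕ) : List (Gate 1 m N) :=
  (List.replicate k (amplifyStep m N r hr)).flatten

theorem amplifyCircuit_cost (m N : ℕ) [NeZero N] (r : ℂ) (hr : ‖r‖ = 1) (k : ℕ) :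
    ((amplifyCircuit m N r hr k).map Gate.cost).sum = 10 * k := by
  induction k with
  | zero => simp [amplifyCircuit]
  | succ k ih =>
    rw [amplifyCircuit] at ih ⊢
    rw [List.replicate_succ, List.flatten_cons, List.map_append, List.sum_append, ih]
    simp [amplifyStep, overlapCircuit, overlapCircuitInv, Gate.cost]
    ring

/-- These bounds give `sin (φ + ψ) ≥ 2 · 0.38 · 0.37 > 0.28` for any two admissible angles, which is
what `angle_sub_le` requires. -/
theorem shiftedCos_mem {x : ℝ} (hx : |x| ≤ 1) :
    37 / 100 ≤ shiftedCos x ∧ shiftedCos x ≤ 231 / 250 := by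
  have := abs_le.1 hx
  unfold shiftedCos
  constructor <;> linarith

theorem sin_arccos_shiftedCos_ge {x : ℝ} (hx : |x| ≤ 1) :
    38 / 100 ≤ Real.sin (Real.arccos (shiftedCos x)) := by
  obtain ⟨h1, h2⟩ := shiftedCos_mem hx
  rw [Real.sin_arccos]
  apply Real.le_sqrt_of_sq_le
  nlinarith

theorem cos_arccos_shiftedCos {x : ℝ} (hx : |x| ≤ 1) :
    Real.cos (Real.arccos (shiftedCos x)) = shiftedCos x := by
  obtain ⟨h1, h2⟩ := shiftedCos_mem hx
  exact Real.cos_arccos (by linarith) (by linarith)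

theorem norm_overlap_le_one {m N : ℕ} (F : Oracles m N) (x y : OracleBasis m N) :
    ‖overlapOp F x y‖ ≤ 1 :=
  entry_norm_bound_of_unitary (overlapOp_mem_unitaryGroup F) x y

theorem abs_re_mul_overlap_le_one {m N : ℕ} (F : Oracles m N) (x y : OracleBasis m N) {r : ℂ}
    (hr : ‖r‖ = 1) : |(r * overlapOp F x y).re| ≤ 1 :=
  (Complex.abs_re_le_norm _).trans (by rw [norm_mul, hr, one_mul]; exact norm_overlap_le_one F x y)

/-- The probability of returning to the initial state after `k` amplification steps. -/
theorem bornProb_amplifyCircuit {m N : ℕ} [NeZero N] (F : Oracles m N) {r : ℂ} (hr : ‖r‖ = 1)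
    (k : ℕ) :
    bornProb F (amplifyCircuit m N r hr k) (fun _ => false, fun _ => false, 0) =
      Real.cos (k * Real.arccos (shiftedCos
        (r * overlapOp F (fun _ => false, 0) (fun _ => false, 0)).re)) ^ 2 := by
  have hx := abs_re_mul_overlap_le_one F (fun _ => false, 0) (fun _ => false, 0) hr
  have hsin := sin_arccos_shiftedCos_ge hx
  rw [bornProb, amplifyCircuit, circuitMat_flatten_replicate, circuitMat_amplifyStep,
    reflection_mul_pow_apply _ _ (overlapReflection_mul_self F hr)
      (by rw [overlapReflection_apply_zero, cos_arccos_shiftedCos hx]) (by linarith),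
    Complex.norm_real, Real.norm_eq_abs, sq_abs]

/-! ### Recovering an angle from the frequencies -/

/-- Repeated doubling cannot jump over `[π/6, π/3]`: the least exponent that reaches `π/6` works. -/
theorem exists_two_pow_mul_mem {D : ℝ} {L : ℕ} (h0 : D < Real.pi / 6)
    (hL : Real.pi / 6 ≤ 2 ^ L * D) :
    ∃ l ≤ L, Real.pi / 6 ≤ 2 ^ l * D ∧ 2 ^ l * D ≤ Real.pi / 3 := by
  classical
  have hex : ∃ l : ℕ, Real.pi / 6 ≤ 2 ^ l * D := ⟨L, hL⟩
  refine ⟨Nat.find hex, Nat.find_min' hex hL, Nat.find_spec hex, ?_⟩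
  obtain ⟨l, hl⟩ : ∃ l, Nat.find hex = l + 1 := by
    refine Nat.exists_eq_succ_of_ne_zero fun h => ?_
    have := Nat.find_spec hex
    rw [h] at this
    linarith
  have hlt := Nat.find_min hex (m := l) (by omega)
  rw [hl, pow_succ]
  linarith

theorem half_le_sin {x : ℝ} (h1 : Real.pi / 6 ≤ x) (h2 : x ≤ 5 * Real.pi / 6) :
    1 / 2 ≤ Real.sin x := by
  rcases le_total x (Real.pi / 2) with h | h
  · rw [← Real.sin_pi_div_six]
    exact Real.sin_le_sin_of_le_of_le_pi_div_two (by linarith [Real.pi_pos]) h h1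
  · rw [← Real.sin_pi_div_six, ← Real.sin_pi_sub x]
    exact Real.sin_le_sin_of_le_of_le_pi_div_two (by linarith [Real.pi_pos]) (by linarith)
      (by linarith)

theorem abs_sin_le_abs_sin_add_abs_sin (x y : ℝ) :
    |Real.sin (x - y)| ≤ |Real.sin x| + |Real.sin y| := by
  rw [Real.sin_sub]
  refine (abs_sub _ _).trans ?_
  rw [abs_mul, abs_mul]
  have h1 := mul_le_mul_of_nonneg_left (Real.abs_cos_le_one y) (abs_nonneg (Real.sin x))
  have h2 := mul_le_mul_of_nonneg_right (Real.abs_cos_le_one x) (abs_nonneg (Real.sin y))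
  linarith

theorem cos_sq_sub_cos_sq (k φ ψ : ℝ) : Real.cos (k * φ) ^ 2 - Real.cos (k * ψ) ^ 2 =
    -(Real.sin (k * (φ + ψ)) * Real.sin (k * (φ - ψ))) := by
  have e1 := Real.sin_sq_add_cos_sq (k * φ)
  have e2 := Real.sin_sq_add_cos_sq (k * ψ)
  rw [mul_add, mul_sub, Real.sin_add, Real.sin_sub]
  linear_combination Real.cos (k * ψ) ^ 2 * e1 - Real.cos (k * φ) ^ 2 * e2

/-- Two angles, bounded away from `0` and `π / 2`, are exponentially close if all the values
`cos² (kφ)` with `k = 2 ^ l` or `k = 2 ^ l + 1` are close to each other. -/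
theorem angle_sub_le {φ ψ : ℝ} {L : ℕ} (hφ0 : 0 ≤ φ) (hφ1 : φ ≤ Real.pi / 2)
    (hψ0 : 0 ≤ ψ) (hsin : 28 / 100 ≤ Real.sin (φ + ψ)) (hle : ψ ≤ φ)
    (h : ∀ l ≤ L, ∀ b < 2,
      |Real.cos (((2 ^ l + b : ℕ) : ℝ) * φ) ^ 2 - Real.cos (((2 ^ l + b : ℕ) : ℝ) * ψ) ^ 2| ≤
        1 / 25) :
    φ - ψ ≤ (1 / 2) ^ L := by
  by_contra hcon
  push Not at hcon
  have hD1 : φ - ψ ≤ Real.pi / 2 := by linarith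
  have hmul : ∀ l ≤ L, ∀ b < 2, |Real.sin (((2 ^ l + b : ℕ) : ℝ) * (φ + ψ))| *
      |Real.sin (((2 ^ l + b : ℕ) : ℝ) * (φ - ψ))| ≤ 1 / 25 := by
    intro l hl b hb
    have := h l hl b hb
    rwa [cos_sq_sub_cos_sq, abs_neg, abs_mul] at this
  rcases le_or_gt (Real.pi / 6) (φ - ψ) with hD | hD
  -- A large difference is already excluded by `k = 1`, since `0.28 · 1/2 > 1/25`.
  · have h1 := hmul 0 (Nat.zero_le _) 0 (by norm_num)
    have h2 : 1 / 2 ≤ Real.sin (φ - ψ) := half_le_sin hD (by linarith [Real.pi_pos])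
    simp only [pow_zero, add_zero, Nat.cast_one, one_mul] at h1
    rw [abs_of_nonneg (by linarith : 0 ≤ Real.sin (φ + ψ)),
      abs_of_nonneg (by linarith : 0 ≤ Real.sin (φ - ψ))] at h1
    nlinarith
  · have hL : Real.pi / 6 ≤ 2 ^ L * (φ - ψ) := by
      have h1 : (2 : ℝ) ^ L * (1 / 2) ^ L = 1 := by rw [← mul_pow]; norm_num
      have h2 : (2 : ℝ) ^ L * (1 / 2) ^ L < 2 ^ L * (φ - ψ) :=
        mul_lt_mul_of_pos_left hcon (by positivity)
      linarith [Real.pi_le_four]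
    obtain ⟨l, hl, hl1, hl2⟩ := exists_two_pow_mul_mem hD hL
    have hpow : (1 : ℝ) ≤ 2 ^ l := one_le_pow₀ (by norm_num)
    have hDnn : 0 ≤ φ - ψ := by linarith
    -- For `k = 2^l` and `k = 2^l + 1` the angle `k(φ - ψ)` lies in `[π/6, 2π/3]`, where the sine is
    -- at least `1/2`; hence the other factor of `cos² kφ - cos² kψ` is small.
    have hsmall : ∀ b < 2, |Real.sin (((2 ^ l + b : ℕ) : ℝ) * (φ + ψ))| ≤ 2 / 25 := by
      intro b hb
      have hb' : (b : ℝ) ≤ 1 := by exact_mod_cast Nat.lt_succ_iff.1 hb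
      have hb0 : (0 : ℝ) ≤ b := Nat.cast_nonneg b
      have hk : 1 / 2 ≤ Real.sin (((2 ^ l + b : ℕ) : ℝ) * (φ - ψ)) := by
        push_cast
        refine half_le_sin ?_ ?_
        · nlinarith
        · have : (2 ^ l + (b : ℝ)) * (φ - ψ) ≤ (2 ^ l + 2 ^ l) * (φ - ψ) :=
            mul_le_mul_of_nonneg_right (by linarith) hDnn
          nlinarith [Real.pi_pos]
      have := hmul l hl b hb
      rw [abs_of_nonneg (by linarith :
        0 ≤ Real.sin (((2 ^ l + b : ℕ) : ℝ) * (φ - ψ)))] at this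
      nlinarith [abs_nonneg (Real.sin (((2 ^ l + b : ℕ) : ℝ) * (φ + ψ)))]
    have h0 := hsmall 0 (by norm_num)
    have h1 := hsmall 1 (by norm_num)
    -- A single `k` may fail because `k(φ + ψ)` is near a multiple of `π`. Two consecutive values
    -- cannot both be: their difference is `φ + ψ`, and `4/25 < 28/100`.
    have h2 := abs_sin_le_abs_sin_add_abs_sin (((2 ^ l + 1 : ℕ) : ℝ) * (φ + ψ))
      (((2 ^ l + 0 : ℕ) : ℝ) * (φ + ψ))
    have h3 : ((2 ^ l + 1 : ℕ) : ℝ) * (φ + ψ) - ((2 ^ l + 0 : ℕ) : ℝ) * (φ + ψ) = φ + ψ := by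
      push_cast
      ring
    rw [h3] at h2
    linarith [le_abs_self (Real.sin (φ + ψ))]

/-- The number of amplification steps in the group of runs indexed by `g`. -/
def stepCount {L : ℕ} (g : Fin 2 × Fin (L + 1)) : ℕ := 2 ^ (g.2 : ℕ) + g.1

/-- The frequencies `f` are compatible with the value `x`. -/
def Consistent {L : ℕ} (f : Fin 2 × Fin (L + 1) → ℝ) (x : ℝ) : Prop :=
  |x| ≤ 1 ∧
    ∀ g, |f g - Real.cos (stepCount g * Real.arccos (shiftedCos x)) ^ 2| ≤ 1 / 50

theorem Consistent.abs_sub_le {L : ℕ} {f : Fin 2 × Fin (L + 1) → ℝ} {x y : ℝ}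
    (hx : Consistent f x) (hy : Consistent f y) : |x - y| ≤ 4 * (1 / 2) ^ L := by
  have main : ∀ {x y : ℝ}, Consistent f x → Consistent f y →
      Real.arccos (shiftedCos y) ≤ Real.arccos (shiftedCos x) → |x - y| ≤ 4 * (1 / 2) ^ L := by
    intro x y hx hy hle
    have cx := cos_arccos_shiftedCos hx.1
    have cy := cos_arccos_shiftedCos hy.1
    have sx := sin_arccos_shiftedCos_ge hx.1
    have sy := sin_arccos_shiftedCos_ge hy.1
    obtain ⟨bx, -⟩ := shiftedCos_mem hx.1
    obtain ⟨b_y, -⟩ := shiftedCos_mem hy.1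
    have hsub := angle_sub_le (L := L) (Real.arccos_nonneg (shiftedCos x))
      (Real.arccos_le_pi_div_two.2 (by linarith)) (Real.arccos_nonneg (shiftedCos y))
      (by rw [Real.sin_add, cx, cy]; nlinarith) hle (by
        intro l hl b hb
        have h1 := hx.2 (⟨b, hb⟩, ⟨l, by omega⟩)
        have h2 := hy.2 (⟨b, hb⟩, ⟨l, by omega⟩)
        simp only [stepCount] at h1 h2
        rw [abs_sub_comm] at h1
        refine (_root_.abs_sub_le _ (f (⟨b, hb⟩, ⟨l, by omega⟩)) _).trans ?_
        linarith)
    have hcos := Real.abs_cos_sub_cos_le (Real.arccos (shiftedCos x)) (Real.arccos (shiftedCos y))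
    rw [cx, cy, abs_of_nonneg (a := Real.arccos (shiftedCos x) - _) (by linarith)] at hcos
    -- The factor 4 in the conclusion is an upper bound for `2197 / 600`.
    have e : shiftedCos x - shiftedCos y = 600 / 2197 * (x - y) := by
      unfold shiftedCos
      ring
    rw [e, abs_mul, abs_of_pos (by norm_num : (0 : ℝ) < 600 / 2197)] at hcos
    linarith [abs_nonneg (x - y)]
  rcases le_total (Real.arccos (shiftedCos y)) (Real.arccos (shiftedCos x)) with h | h
  · exact main hx hy h
  · rw [abs_sub_comm]
    exact main hy hx h

open Classical in
/-- A value compatible with the given frequencies, if there is one. -/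
def solveFrequencies {L : ℕ} (f : Fin 2 × Fin (L + 1) → ℝ) : ℝ :=
  -- The value 0 is a default for inconsistent frequencies, which occur only on the failure event.
  if h : ∃ x, Consistent f x then h.choose else 0

theorem abs_solveFrequencies_sub_le {L : ℕ} {f : Fin 2 × Fin (L + 1) → ℝ} {x : ℝ}
    (hx : Consistent f x) : |solveFrequencies f - x| ≤ 4 * (1 / 2) ^ L := by
  have h : ∃ x, Consistent f x := ⟨x, hx⟩
  rw [solveFrequencies, dif_pos h]
  exact h.choose_spec.abs_sub_le hx

/-! ### The estimator -/

/-- Indices of the groups of identical runs: real or imaginary part, and the number of steps. -/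
abbrev RunGroup (L : ℕ) : Type := Bool × Fin 2 × Fin (L + 1)

/-- The phase that selects the real or the imaginary part. -/
def phase (b : Bool) : ℂ := bif b then -Complex.I else 1

theorem norm_phase (b : Bool) : ‖phase b‖ = 1 := by
  cases b <;> simp [phase]

/-- The runs are indexed by the group and the number of the shot. -/
def runEquiv (L n : ℕ) : Fin (Fintype.card (RunGroup L × Fin n)) ≃ RunGroup L × Fin n :=
  (Fintype.equivFin _).symm

/-- The runs that belong to the group `g`. -/
def groupRuns (L n : ℕ) (g : RunGroup L) : Finset (Fin (Fintype.card (RunGroup L × Fin n))) :=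
  Finset.univ.filter fun r => (runEquiv L n r).1 = g

theorem card_groupRuns (L n : ℕ) (g : RunGroup L) : (groupRuns L n g).card = n := by
  refine (Finset.card_bij (s := (Finset.univ : Finset (Fin n)))
    (fun i _ => (runEquiv L n).symm (g, i)) (fun i _ => ?_) (fun i _ j _ h => ?_)
    fun r hr => ?_).symm.trans (by simp)
  · simp [groupRuns]
  · simpa using h
  · refine ⟨(runEquiv L n r).2, Finset.mem_univ _, ?_⟩
    rw [Equiv.symm_apply_eq, ← (Finset.mem_filter.1 hr).2]

/-- The frequency of the initial state among the outcomes in the group `g`. -/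
def frequency {m N L n : ℕ} [NeZero N]
    (z : Fin (Fintype.card (RunGroup L × Fin n)) → Basis 1 m N) (g : RunGroup L) : ℝ :=
  (∑ r ∈ groupRuns L n g, if z r = (fun _ => false, fun _ => false, 0) then 1 else 0) / n

/-- The circuits of the estimator. -/
def estimatorCircuit (m N : ℕ) [NeZero N] (L n : ℕ) (r : Fin (Fintype.card (RunGroup L × Fin n))) :
    List (Gate 1 m N) :=
  amplifyCircuit m N (phase (runEquiv L n r).1.1) (norm_phase _) (stepCount (runEquiv L n r).1.2)

/-- The classical post-processing of the estimator. -/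
def estimatorPost {m N L n : ℕ} [NeZero N] (α : ℝ)
    (z : Fin (Fintype.card (RunGroup L × Fin n)) → Basis 1 m N) : ℂ :=
  α * (solveFrequencies (fun g => frequency z (false, g)) +
    solveFrequencies (fun g => frequency z (true, g)) * Complex.I)

/-- The estimator of `α ⟨0|V|0⟩` with `2 ^ L` amplification steps and `n` shots. -/
def amplitudeEstimator (m N : ℕ) [NeZero N] (α : ℝ) (L n : ℕ) : Estimator m N where
  q := 1
  runs := Fintype.card (RunGroup L × Fin n)
  circuit := estimatorCircuit m N L n
  post := estimatorPost α

/-- Each step costs 10 queries, there are two phases with `n` shots each, and the geometric sum of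
`2^l + (2^l + 1)` over `l ≤ L` is at most `5 · 2^L`. -/
theorem amplitudeEstimator_queries_le (m N : ℕ) [NeZero N] (α : ℝ) (L n : ℕ) :
    (amplitudeEstimator m N α L n).queries ≤ 100 * (n * 2 ^ L) := by
  have h1 : (amplitudeEstimator m N α L n).queries =
      ∑ r, 10 * stepCount (runEquiv L n r).1.2 :=
    Finset.sum_congr rfl fun r _ => amplifyCircuit_cost _ _ _ _ _
  rw [h1, Equiv.sum_comp (runEquiv L n) fun x => 10 * stepCount x.1.2]
  simp only [Fintype.sum_prod_type, Finset.sum_const, Finset.card_univ, Fintype.card_fin,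
    Fintype.card_bool, Fin.sum_univ_two, stepCount, smul_eq_mul, ← Finset.mul_sum,
    Finset.sum_add_distrib, Fin.sum_univ_eq_sum_range (fun i => 2 ^ i)]
  have h2 : ∑ i ∈ Finset.range (L + 1), 2 ^ i + 1 = 2 * 2 ^ L := by
    have := Nat.geomSum_eq (le_refl 2) (L + 1)
    rw [this]
    have : 1 ≤ 2 ^ (L + 1) := Nat.one_le_two_pow
    omega
  have h3 : L + 1 ≤ 2 ^ L := Nat.lt_two_pow_self
  simp only [Fin.val_zero, Fin.val_one]
  generalize ∑ i ∈ Finset.range (L + 1), 2 ^ i = s at *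
  have h4 : s + (L + 1) * 0 + (s + (L + 1) * 1) ≤ 5 * 2 ^ L := by omega
  nlinarith

theorem abs_ite_sub_le_one {p : ℝ} (h0 : 0 ≤ p) (h1 : p ≤ 1) (P : Prop) [Decidable P] :
    |(if P then 1 else 0) - p| ≤ 1 := by
  split_ifs <;> rw [abs_le] <;> constructor <;> linarith

/-- Each of the `4(L + 1)` groups of runs misses its frequency by `1/50` with probability at most `2
exp (-n/5000)`, by Hoeffding. Off the union of these events the true values are `Consistent`, so any
other consistent choice is close to them. -/
theorem estimatorPost_spec {m N : ℕ} [NeZero N] {α : ℝ} (hα : 0 ≤ α) (L n : ℕ)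
    (F : Oracles m N) :
    1 - 8 * (L + 1) * Real.exp (-(n / 5000)) ≤
      eventProb (fun z : Fin (Fintype.card (RunGroup L × Fin n)) → Basis 1 m N =>
          ∏ r, bornProb F (estimatorCircuit m N L n r) (z r))
        {z | ‖estimatorPost α z - α * overlapOp F (fun _ => false, 0) (fun _ => false, 0)‖ ≤
          8 * α * (1 / 2) ^ L} := by
  set a := overlapOp F (fun _ => false, 0) (fun _ => false, 0) with ha
  have hp := fun r => bornProb_isProbWeight F (estimatorCircuit m N L n r)
  set W := fun z : Fin (Fintype.card (RunGroup L × Fin n)) → Basis 1 m N =>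
    ∏ r, bornProb F (estimatorCircuit m N L n r) (z r)
  have hw : IsProbWeight W := IsProbWeight.pi hp
  set z₀ : Basis 1 m N := (fun _ => false, fun _ => false, 0) with hz₀
  have hprob : ∀ r, bornProb F (estimatorCircuit m N L n r) z₀ = Real.cos (stepCount (runEquiv L n r).1.2 *
      Real.arccos (shiftedCos (phase (runEquiv L n r).1.1 * a).re)) ^ 2 := fun r =>
    bornProb_amplifyCircuit F (norm_phase _) _
  let X : Fin (Fintype.card (RunGroup L × Fin n)) → Basis 1 m N → ℝ := fun r z =>
    (if z = z₀ then 1 else 0) - bornProb F (estimatorCircuit m N L n r) z₀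
  have hX : ∀ r z, |X r z| ≤ 1 := fun r z =>
    abs_ite_sub_le_one ((hp r).nonneg _) (by rw [hprob]; exact Real.cos_sq_le_one _) _
  have hmean : ∀ r, ∑ z, bornProb F (estimatorCircuit m N L n r) z * X r z = 0 := fun r => by
    simp only [X, mul_sub, Finset.sum_sub_distrib, ← Finset.sum_mul,
      (hp r).sum_eq_one]
    simp
  let E : RunGroup L → Set (Fin (Fintype.card (RunGroup L × Fin n)) → Basis 1 m N) := fun g =>
    {z | (groupRuns L n g).card * (1 / 50 : ℝ) ≤ |∑ r ∈ groupRuns L n g, X r (z r)|}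
  have hE : ∀ g, eventProb W (E g) ≤ 2 * Real.exp (-(n / 5000)) := fun g => by
    have := eventProb_abs_sum_ge_le hp
      (groupRuns L n g) (X := X) one_pos (by norm_num : (0 : ℝ) < 1 / 50)
      (fun r _ z => hX r z) (fun r _ => hmean r)
    refine this.trans_eq ?_
    rw [card_groupRuns]
    congr 3
    ring
  have hbad : eventProb W (⋃ g, E g) ≤ 8 * (L + 1) * Real.exp (-(n / 5000)) := by
    refine (eventProb_iUnion_le hw E).trans ((Finset.sum_le_sum fun g _ => hE g).trans_eq ?_)
    rw [Finset.sum_const, Finset.card_univ, Fintype.card_prod, Fintype.card_prod,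
      Fintype.card_bool, Fintype.card_fin, Fintype.card_fin, nsmul_eq_mul]
    push_cast
    ring
  have hgood : 1 - 8 * (L + 1) * Real.exp (-(n / 5000)) ≤
      eventProb W (⋃ g, E g)ᶜ := by
    rw [eventProb_compl hw]
    linarith
  refine hgood.trans (eventProb_mono hw fun z hz => ?_)
  have hcons : ∀ b, Consistent (fun g => frequency z (b, g)) (phase b * a).re := fun b => by
    refine ⟨abs_re_mul_overlap_le_one F _ _ (norm_phase b), fun g => ?_⟩
    have hzg : z ∉ E (b, g) := fun h => hz (Set.mem_iUnion.2 ⟨_, h⟩)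
    simp only [E, Set.mem_ofPred_eq, not_le, card_groupRuns] at hzg
    -- With `n = 0` every outcome is in the bad event, so a good outcome forces `n > 0`.
    have hn : (0 : ℝ) < n := by
      have := (abs_nonneg _).trans_lt hzg
      linarith
    have hsum : ∑ r ∈ groupRuns L n (b, g), X r (z r) = n * (frequency z (b, g) -
        Real.cos (stepCount g * Real.arccos (shiftedCos (phase b * a).re)) ^ 2) := by
      have hc : ∀ r ∈ groupRuns L n (b, g), X r (z r) = (if z r = z₀ then 1 else 0) -
          Real.cos (stepCount g * Real.arccos (shiftedCos (phase b * a).re)) ^ 2 := by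
        intro r hr
        simp only [X]
        rw [hprob, (Finset.mem_filter.1 hr).2]
      rw [Finset.sum_congr rfl hc, Finset.sum_sub_distrib, Finset.sum_const, card_groupRuns,
        nsmul_eq_mul, mul_sub, frequency, mul_div_cancel₀ _ hn.ne']
    rw [hsum, abs_mul, abs_of_pos hn] at hzg
    exact (lt_of_mul_lt_mul_left hzg hn.le).le
  have h0 := abs_solveFrequencies_sub_le (hcons false)
  have h1 := abs_solveFrequencies_sub_le (hcons true)
  have e0 : (phase false * a).re = a.re := by simp [phase]
  have e1 : (phase true * a).re = a.im := by simp [phase]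
  rw [e0] at h0
  rw [e1] at h1
  change ‖(α : ℂ) * (solveFrequencies (fun g => frequency z (false, g)) +
    solveFrequencies (fun g => frequency z (true, g)) * Complex.I) - α * a‖ ≤ _
  generalize solveFrequencies (fun g => frequency z (false, g)) = x at *
  generalize solveFrequencies (fun g => frequency z (true, g)) = y at *
  rw [← mul_sub, norm_mul, Complex.norm_real, Real.norm_of_nonneg hα]
  -- Real and imaginary part each contribute `4 · 2^(-L)`.
  have h2 : ‖(x : ℂ) + y * Complex.I - a‖ ≤ |x - a.re| + |y - a.im| := by
    refine (Complex.norm_le_abs_re_add_abs_im _).trans_eq ?_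
    simp
  calc α * ‖(x : ℂ) + y * Complex.I - a‖ ≤ α * (8 * (1 / 2) ^ L) :=
        mul_le_mul_of_nonneg_left (by linarith) hα
    _ = _ := by ring

/-- The estimator is accurate with high probability. -/
theorem amplitudeEstimator_spec {m N : ℕ} [NeZero N] {α : ℝ} (hα : 0 ≤ α) (L n : ℕ)
    (F : Oracles m N) :
    1 - 8 * (L + 1) * Real.exp (-(n / 5000)) ≤
      eventProb ((amplitudeEstimator m N α L n).prob F)
        {z | ‖(amplitudeEstimator m N α L n).post z -
          α * overlapOp F (fun _ => false, 0) (fun _ => false, 0)‖ ≤ 8 * α * (1 / 2) ^ L} :=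
  estimatorPost_spec hα L n F

/-! ### The amplitude in terms of the observable -/

theorem one_kronecker_mul_mul_apply {m N : ℕ} (X Y : Matrix (Fin N) (Fin N) ℂ)
    (U : Matrix (OracleBasis m N) (OracleBasis m N) ℂ) (x : Qubits m) (i j : Fin N) :
    (((1 : Matrix (Qubits m) (Qubits m) ℂ) ⊗ₖ X) *
      (U * ((1 : Matrix (Qubits m) (Qubits m) ℂ) ⊗ₖ Y))) (x, i) (x, j) =
      (X * (U.submatrix (fun i => (x, i)) (fun i => (x, i)) * Y)) i j := by
  simp only [Matrix.mul_apply, Fintype.sum_prod_type, Matrix.kroneckerMap_apply,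
    Matrix.submatrix_apply]
  rw [Finset.sum_eq_single x (fun y _ hy => by simp [Matrix.one_apply_ne (Ne.symm hy)])
    (by simp)]
  refine Finset.sum_congr rfl fun k _ => ?_
  rw [Finset.sum_eq_single x (fun y _ hy => by simp [Matrix.one_apply_ne hy]) (by simp)]
  simp

/-- All factors except the block encoding act trivially on its ancillas, so only its block at `|0⟩`
enters. -/
theorem overlapOp_apply_zero {m N : ℕ} [NeZero N] {α : ℝ} (hα : α ≠ 0)
    {O : Matrix (Fin N) (Fin N) ℂ} (F : Oracles m N) (h : IsBlockEncoding α O F.obs) :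
    α * overlapOp F (fun _ => false, 0) (fun _ => false, 0) =
      star ((F.prep : Matrix (Fin N) (Fin N) ℂ) *ᵥ Pi.single 0 1) ⬝ᵥ
        (((F.evol : Matrix (Fin N) (Fin N) ℂ)ᴴ * O * (F.evol' : Matrix (Fin N) (Fin N) ℂ)) *ᵥ
          ((F.prep : Matrix (Fin N) (Fin N) ℂ) *ᵥ Pi.single 0 1)) := by
  have h1 : overlapOp F =
      (1 ⊗ₖ ((F.prep : Matrix (Fin N) (Fin N) ℂ)ᴴ * (F.evol : Matrix (Fin N) (Fin N) ℂ)ᴴ)) *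
        ((F.obs : Matrix (OracleBasis m N) (OracleBasis m N) ℂ) *
          (1 ⊗ₖ ((F.evol' : Matrix (Fin N) (Fin N) ℂ) * (F.prep : Matrix (Fin N) (Fin N) ℂ)))) := by
    simp only [overlapOp, Oracles.op, Matrix.conjTranspose_kronecker, Matrix.conjTranspose_one]
    rw [← Matrix.mul_kronecker_mul, ← mul_assoc, ← Matrix.mul_kronecker_mul, one_mul]
  rw [h1, one_kronecker_mul_mul_apply, h]
  have hα' : (α : ℂ) ≠ 0 := by exact_mod_cast hα
  generalize (F.prep : Matrix (Fin N) (Fin N) ℂ) = A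
  generalize (F.evol : Matrix (Fin N) (Fin N) ℂ) = B
  generalize (F.evol' : Matrix (Fin N) (Fin N) ℂ) = D
  rw [Matrix.star_mulVec, ← Matrix.dotProduct_mulVec, Matrix.mulVec_mulVec, Matrix.mulVec_mulVec,
    Matrix.mulVec_single_one]
  have h2 : star (Pi.single 0 1 : Fin N → ℂ) = Pi.single 0 1 := by
    funext i
    by_cases hi : i = 0
    · subst hi
      simp
    · simp [hi]
  rw [h2, single_dotProduct, one_mul]
  simp only [Matrix.col_apply, Matrix.smul_mul, Matrix.mul_smul, Matrix.smul_apply, smul_eq_mul,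
    mul_assoc]
  push_cast
  field_simp

/-! ### Euler's method -/

section Euler

variable {E : Type*} [NormedAddCommGroup E] [InnerProductSpace ℂ E]

/-- Euler's method with step `Δ` for `y' = B y`, `y 0 = v`. -/
def euler (B : ℝ → E →L[ℂ] E) (Δ : ℝ) (v : E) : ℕ → E
  | 0 => v
  | i + 1 => euler B Δ v i + Δ • B (i * Δ) (euler B Δ v i)

/-- Local error of Euler's method: the mean value inequality for `y s - s • φ a`, whose derivative
is `φ s - φ a`. -/
theorem norm_sub_sub_smul_le {y φ : ℝ → E} {t a Δ ω : ℝ} (ha : 0 ≤ a) (hΔ : 0 ≤ Δ)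
    (hat : a + Δ ≤ t) (hy : ∀ s ∈ Set.Icc 0 t, HasDerivWithinAt y (φ s) (Set.Icc 0 t) s)
    (hφ : ∀ s ∈ Set.Icc a (a + Δ), ‖φ s - φ a‖ ≤ ω) :
    ‖y (a + Δ) - y a - Δ • φ a‖ ≤ ω * Δ := by
  have hsub : Set.Icc a (a + Δ) ⊆ Set.Icc 0 t := Set.Icc_subset_Icc ha hat
  have := norm_image_sub_le_of_norm_deriv_le_segment' (f := fun s => y s - s • φ a)
    (f' := fun s => φ s - φ a) (a := a) (b := a + Δ) (C := ω)
    (fun s hs => by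
      have h2 : HasDerivWithinAt (fun s : ℝ => s • φ a) ((1 : ℝ) • φ a) (Set.Icc a (a + Δ)) s :=
        (hasDerivWithinAt_id s _).smul_const _
      rw [one_smul] at h2
      exact ((hy s (hsub hs)).mono hsub).sub h2)
    (fun s hs => hφ s (Set.Ico_subset_Icc_self hs)) (a + Δ)
    (Set.right_mem_Icc.2 (by linarith))
  have e : y (a + Δ) - y a - Δ • φ a = y (a + Δ) - (a + Δ) • φ a - (y a - a • φ a) := by
    rw [add_smul]
    abel
  rw [e]
  simpa using this

theorem one_add_pow_le_exp {x : ℝ} (hx : 0 ≤ x) (n : ℕ) : (1 + x) ^ n ≤ Real.exp (n * x) := by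
  rw [Real.exp_nat_mul]
  exact pow_le_pow_left₀ (by linarith) (by linarith [Real.add_one_le_exp x]) n

/-- Every step adds a local error `ωΔ` and amplifies the earlier error by at most `1 + ΔC`. -/
theorem norm_euler_sub_le {B : ℝ → E →L[ℂ] E} {y : ℝ → E} {t Δ ω C : ℝ} {n : ℕ} (hΔ : 0 ≤ Δ)
    (hn : n * Δ ≤ t) (hC0 : 0 ≤ C) (hω : 0 ≤ ω)
    (hy : ∀ s ∈ Set.Icc 0 t, HasDerivWithinAt y (B s (y s)) (Set.Icc 0 t) s)
    (hC : ∀ s ∈ Set.Icc 0 t, ‖B s‖ ≤ C)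
    (hmod : ∀ s ∈ Set.Icc 0 t, ∀ r ∈ Set.Icc 0 t, |s - r| ≤ Δ →
      ‖B s (y s) - B r (y r)‖ ≤ ω) (i : ℕ) (hi : i ≤ n) :
    ‖euler B Δ (y 0) i - y (i * Δ)‖ ≤ i * Δ * ω * (1 + Δ * C) ^ i := by
  induction i with
  | zero => simp [euler]
  | succ i ih =>
    have hin : ((i + 1 : ℕ) : ℝ) * Δ ≤ t :=
      (mul_le_mul_of_nonneg_right (by exact_mod_cast hi) hΔ).trans hn
    have hi0 : 0 ≤ (i : ℝ) * Δ := by positivity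
    have e1 : ((i + 1 : ℕ) : ℝ) * Δ = i * Δ + Δ := by push_cast; ring
    rw [e1] at hin ⊢
    have hit : (i : ℝ) * Δ ∈ Set.Icc 0 t := ⟨hi0, by linarith⟩
    have hloc := norm_sub_sub_smul_le (φ := fun s => B s (y s)) hi0 hΔ hin hy
      fun s hs => hmod s ⟨by linarith [hs.1], by linarith [hs.2]⟩ _ hit
        (by rw [abs_le]; constructor <;> linarith [hs.1, hs.2])
    have hih := ih (by omega)
    set e := euler B Δ (y 0) i - y (i * Δ) with he
    have hstep : euler B Δ (y 0) (i + 1) - y (i * Δ + Δ) =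
        (e + Δ • B (i * Δ) e) - (y (i * Δ + Δ) - y (i * Δ) - Δ • B (i * Δ) (y (i * Δ))) := by
      simp only [euler, he, map_sub, smul_sub]
      abel
    have hq : 1 ≤ 1 + Δ * C := by nlinarith
    have hBe : ‖e + Δ • B (i * Δ) e‖ ≤ (1 + Δ * C) * ‖e‖ := by
      refine (norm_add_le _ _).trans ?_
      rw [norm_smul, Real.norm_of_nonneg hΔ]
      have := (B (i * Δ)).le_of_opNorm_le (hC _ hit) e
      nlinarith
    rw [hstep]
    refine (norm_sub_le _ _).trans ((add_le_add hBe hloc).trans ?_)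
    have hqi : 1 ≤ (1 + Δ * C) ^ (i + 1) := one_le_pow₀ hq
    have h1 : (1 + Δ * C) * ‖e‖ ≤ (1 + Δ * C) * (i * Δ * ω * (1 + Δ * C) ^ i) :=
      mul_le_mul_of_nonneg_left hih (by linarith)
    have h2 : ω * Δ ≤ ω * Δ * (1 + Δ * C) ^ (i + 1) := le_mul_of_one_le_right (by positivity) hqi
    calc (1 + Δ * C) * ‖e‖ + ω * Δ
        ≤ (1 + Δ * C) * (i * Δ * ω * (1 + Δ * C) ^ i) + ω * Δ * (1 + Δ * C) ^ (i + 1) :=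
          add_le_add h1 h2
      _ = _ := by ring

/-- Euler's method converges. -/
theorem tendsto_euler {B : ℝ → E →L[ℂ] E} {y : ℝ → E} {t : ℝ} (ht : 0 ≤ t)
    (hB : ContinuousOn B (Set.Icc 0 t))
    (hy : ∀ s ∈ Set.Icc 0 t, HasDerivWithinAt y (B s (y s)) (Set.Icc 0 t) s) :
    Filter.Tendsto (fun n : ℕ => euler B (t / n) (y 0) n) Filter.atTop (nhds (y t)) := by
  have hyc : ContinuousOn y (Set.Icc 0 t) := fun s hs => (hy s hs).continuousWithinAt
  have hφ : ContinuousOn (fun s => B s (y s)) (Set.Icc 0 t) := hB.clm_apply hyc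
  obtain ⟨C, hC⟩ := isCompact_Icc.exists_bound_of_continuousOn hB
  have hC0 : 0 ≤ C := (norm_nonneg _).trans (hC 0 ⟨le_rfl, ht⟩)
  have huc := isCompact_Icc.uniformContinuousOn_of_continuous hφ
  rw [Metric.uniformContinuousOn_iff] at huc
  rw [Metric.tendsto_atTop]
  intro η hη
  -- The modulus is chosen so that the global error is at most `η/2 · t/(t + 1)`; `t + 1` instead of
  -- `t` covers `t = 0`.
  obtain ⟨ρ, hρ, hmod⟩ := huc (η / (2 * (t + 1) * Real.exp (t * C))) (by positivity)
  obtain ⟨n₀, hn₀⟩ := exists_nat_gt (t / ρ)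
  refine ⟨n₀ + 1, fun n hn => ?_⟩
  have hn1 : (n₀ : ℝ) + 1 ≤ n := by exact_mod_cast hn
  have hnpos : (0 : ℝ) < n := by
    have : (0 : ℝ) ≤ n₀ := Nat.cast_nonneg _
    linarith
  have hΔ : t / n < ρ := by
    rw [div_lt_iff₀ hnpos]
    rw [div_lt_iff₀ hρ] at hn₀
    nlinarith
  have hnt : (n : ℝ) * (t / n) = t := by field_simp
  have hmain := norm_euler_sub_le (n := n) (Δ := t / n)
    (ω := η / (2 * (t + 1) * Real.exp (t * C))) (by positivity) hnt.le hC0 (by positivity) hy hC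
    (fun s hs r hr hsr => by
      have := hmod s hs r hr (by rw [Real.dist_eq]; linarith)
      rw [dist_eq_norm] at this
      exact this.le) n le_rfl
  rw [hnt] at hmain
  rw [dist_eq_norm]
  have hexp : (1 + t / n * C) ^ n ≤ Real.exp (t * C) := by
    refine (one_add_pow_le_exp (by positivity) n).trans_eq ?_
    rw [← mul_assoc, hnt]
  calc ‖euler B (t / n) (y 0) n - y t‖
      ≤ t * (η / (2 * (t + 1) * Real.exp (t * C))) * (1 + t / n * C) ^ n := hmain
    _ ≤ t * (η / (2 * (t + 1) * Real.exp (t * C))) * Real.exp (t * C) :=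
        mul_le_mul_of_nonneg_left hexp (by positivity)
    _ = t / (t + 1) * (η / 2) := by
        have := (Real.exp_pos (t * C)).ne'
        field_simp
    _ ≤ 1 * (η / 2) := mul_le_mul_of_nonneg_right
        ((div_le_one (by linarith)).2 (by linarith)) (by linarith)
    _ < η := by linarith

/-- Dissipativity removes the first-order term of `‖v + ΔBv‖²`. The growth per step is thus `1 +
O(Δ²)`, and over `n` steps of size `t/n` it tends to one however large `C` is. -/
theorem norm_add_smul_le {B : E →L[ℂ] E} {C Δ : ℝ} (hΔ : 0 ≤ Δ) (hC : ‖B‖ ≤ C) (v : E)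
    (hdiss : (inner ℂ v (B v)).re ≤ 0) : ‖v + Δ • B v‖ ≤ (1 + Δ ^ 2 * C ^ 2) * ‖v‖ := by
  have hBv := B.le_of_opNorm_le hC v
  have hC0 : 0 ≤ C := (norm_nonneg _).trans hC
  have h1 : ‖v + Δ • B v‖ ^ 2 = ‖v‖ ^ 2 + 2 * (Δ * (inner ℂ v (B v)).re) + Δ ^ 2 * ‖B v‖ ^ 2 := by
    rw [norm_add_sq (𝕜 := ℂ), norm_smul, Real.norm_of_nonneg hΔ, ← Complex.coe_smul Δ (B v),
      inner_smul_right, mul_pow]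
    simp
  have h2 : ‖B v‖ ^ 2 ≤ (C * ‖v‖) ^ 2 := pow_le_pow_left₀ (norm_nonneg _) hBv 2
  have h3 : Δ * (inner ℂ v (B v)).re ≤ 0 := mul_nonpos_of_nonneg_of_nonpos hΔ hdiss
  have h4 : Δ ^ 2 * ‖B v‖ ^ 2 ≤ Δ ^ 2 * (C * ‖v‖) ^ 2 :=
    mul_le_mul_of_nonneg_left h2 (sq_nonneg _)
  refine abs_le_of_sq_le_sq' ?_ (by positivity) |>.2
  rw [h1]
  have h5 : 0 ≤ (Δ ^ 2 * C ^ 2) * ‖v‖ ^ 2 := by positivity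
  have h6 : 0 ≤ (Δ ^ 2 * C ^ 2) ^ 2 * ‖v‖ ^ 2 := by positivity
  nlinarith

theorem norm_euler_le {B : ℝ → E →L[ℂ] E} {C Δ : ℝ} {n : ℕ} (hΔ : 0 ≤ Δ)
    (hC : ∀ i < n, ‖B (i * Δ)‖ ≤ C)
    (hdiss : ∀ i < n, ∀ v, (inner ℂ v (B (i * Δ) v)).re ≤ 0) (v : E) (i : ℕ) (hi : i ≤ n) :
    ‖euler B Δ v i‖ ≤ (1 + Δ ^ 2 * C ^ 2) ^ i * ‖v‖ := by
  induction i with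
  | zero => simp [euler]
  | succ i ih =>
    refine (norm_add_smul_le hΔ (hC i hi) _ (hdiss i hi _)).trans ?_
    rw [pow_succ' (1 + Δ ^ 2 * C ^ 2), mul_assoc]
    exact mul_le_mul_of_nonneg_left (ih (by omega)) (by positivity)

/-- The generator `-i (H + κ L)`. -/
def generator (H L : ℝ → E →L[ℂ] E) (κ : ℂ) (s : ℝ) : E →L[ℂ] E :=
  -Complex.I • (H s + κ • L s)

/-- An Euler iterate is a polynomial in `κ`; this replaces analytic dependence of the exact solution
on `κ`. -/
theorem differentiable_euler (H L : ℝ → E →L[ℂ] E) (Δ : ℝ) (v : E) (i : ℕ) :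
    Differentiable ℂ fun κ => euler (generator H L κ) Δ v i := by
  induction i with
  | zero => exact differentiable_const _
  | succ i ih =>
    simp only [euler, generator, smul_apply, add_apply]
    refine ih.add (Differentiable.const_smul (Differentiable.const_smul
      (((H _).differentiable.comp ih).add
        (differentiable_id.smul ((L _).differentiable.comp ih))) _) Δ)

/-- Discrete Duhamel formula: the difference follows the dissipative Euler scheme with source `-iΔ(κ
- κ')L y`. The Lipschitz constant in `κ` involves `L` only; `H` enters merely through the factor
that tends to one. -/
theorem norm_euler_sub_euler_le {H L : ℝ → E →L[ℂ] E} {κ κ' : ℂ} {C Δ Λ : ℝ} {n : ℕ}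
    (hΔ : 0 ≤ Δ) (hΛ : ∀ i < n, ‖L (i * Δ)‖ ≤ Λ)
    (hC : ∀ i < n, ‖generator H L κ (i * Δ)‖ ≤ C)
    (hC' : ∀ i < n, ‖generator H L κ' (i * Δ)‖ ≤ C)
    (hdiss : ∀ i < n, ∀ v, (inner ℂ v (generator H L κ (i * Δ) v)).re ≤ 0)
    (hdiss' : ∀ i < n, ∀ v, (inner ℂ v (generator H L κ' (i * Δ) v)).re ≤ 0)
    (v : E) (i : ℕ) (hi : i ≤ n) :
    ‖euler (generator H L κ) Δ v i - euler (generator H L κ') Δ v i‖ ≤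
      i * Δ * Λ * ‖κ - κ'‖ * (1 + Δ ^ 2 * C ^ 2) ^ i * ‖v‖ := by
  induction i with
  | zero => simp [euler]
  | succ i ih =>
    have hih := ih (by omega)
    have hΛ0 : 0 ≤ Λ := (norm_nonneg _).trans (hΛ i hi)
    set x := euler (generator H L κ) Δ v i with hx
    set y := euler (generator H L κ') Δ v i with hy
    have hyn : ‖y‖ ≤ (1 + Δ ^ 2 * C ^ 2) ^ i * ‖v‖ := norm_euler_le hΔ hC' hdiss' v i (by omega)
    have e : euler (generator H L κ) Δ v (i + 1) - euler (generator H L κ') Δ v (i + 1) =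
        ((x - y) + Δ • generator H L κ (i * Δ) (x - y)) +
          Δ • (-Complex.I • ((κ - κ') • L (i * Δ) y)) := by
      simp only [euler, generator, smul_apply, add_apply,
        map_sub, smul_add, smul_sub, sub_smul, ← hx, ← hy]
      abel
    have h1 := norm_add_smul_le hΔ (hC i hi) (x - y) (hdiss i hi _)
    have h2 : ‖Δ • (-Complex.I • ((κ - κ') • L (i * Δ) y))‖ ≤
        Δ * (‖κ - κ'‖ * (Λ * ((1 + Δ ^ 2 * C ^ 2) ^ i * ‖v‖))) := by
      rw [norm_smul, norm_smul, norm_smul, Real.norm_of_nonneg hΔ, norm_neg, Complex.norm_I,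
        one_mul]
      have := ((L (i * Δ)).le_of_opNorm_le (hΛ i hi) y).trans
        (mul_le_mul_of_nonneg_left hyn hΛ0)
      gcongr
    rw [e]
    refine (norm_add_le _ _).trans ((add_le_add h1 h2).trans ?_)
    set q := 1 + Δ ^ 2 * C ^ 2 with hq
    have hq1 : 1 ≤ q := by
      have : 0 ≤ Δ ^ 2 * C ^ 2 := by positivity
      linarith
    have h3 : q * ‖x - y‖ ≤ q * (i * Δ * Λ * ‖κ - κ'‖ * q ^ i * ‖v‖) :=
      mul_le_mul_of_nonneg_left hih (by linarith)
    have h4 : Δ * (‖κ - κ'‖ * (Λ * (q ^ i * ‖v‖))) ≤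
        Δ * (‖κ - κ'‖ * (Λ * (q ^ (i + 1) * ‖v‖))) := by
      have : q ^ i ≤ q ^ (i + 1) := pow_le_pow_right₀ hq1 (Nat.le_succ i)
      gcongr
    push_cast
    calc q * ‖x - y‖ + Δ * (‖κ - κ'‖ * (Λ * (q ^ i * ‖v‖)))
        ≤ q * (i * Δ * Λ * ‖κ - κ'‖ * q ^ i * ‖v‖) +
          Δ * (‖κ - κ'‖ * (Λ * (q ^ (i + 1) * ‖v‖))) := add_le_add h3 h4
      _ = _ := by ring

end Euler

/-! ### The Cauchy kernel -/

section Kernel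

/-- The density of the Cauchy distribution. -/
def cauchyKernel (x : ℝ) : ℝ := (Real.pi * (1 + x ^ 2))⁻¹

theorem cauchyKernel_pos (x : ℝ) : 0 < cauchyKernel x := by
  unfold cauchyKernel
  positivity

theorem continuous_cauchyKernel : Continuous cauchyKernel := by
  unfold cauchyKernel
  refine Continuous.inv₀ (by fun_prop) fun x => ?_
  positivity

theorem integral_cauchyKernel (K : ℝ) :
    ∫ x in (-K)..K, cauchyKernel x = 2 / Real.pi * Real.arctan K := by
  have : ∀ x, cauchyKernel x = Real.pi⁻¹ * (1 + x ^ 2)⁻¹ := fun x => by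
    rw [cauchyKernel, mul_inv]
  simp only [this]
  rw [intervalIntegral.integral_const_mul, integral_inv_one_add_sq, Real.arctan_neg]
  ring

theorem integral_cauchyKernel_le_one (K : ℝ) : ∫ x in (-K)..K, cauchyKernel x ≤ 1 := by
  rw [integral_cauchyKernel]
  have := Real.arctan_lt_pi_div_two K
  have hpi := Real.pi_pos
  rw [div_mul_eq_mul_div, div_le_one hpi]
  linarith

/-- The missing tail mass is `(2/π) arctan (1/K)`, and `arctan x ≤ x` for `x ≥ 0`. -/
theorem one_sub_integral_cauchyKernel_le {K : ℝ} (hK : 0 < K) :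
    |(∫ x in (-K)..K, cauchyKernel x) - 1| ≤ 1 / K := by
  have h1 := integral_cauchyKernel_le_one K
  rw [abs_sub_comm, abs_of_nonneg (by linarith), integral_cauchyKernel]
  have h2 := Real.arctan_inv_of_pos hK
  have h3 : Real.arctan K⁻¹ ≤ K⁻¹ := by
    have := Real.le_tan (x := Real.arctan K⁻¹) (Real.arctan_nonneg.2 (by positivity))
      (Real.arctan_lt_pi_div_two _)
    rwa [Real.tan_arctan] at this
  have hpi := Real.pi_gt_three
  have e : 1 - 2 / Real.pi * Real.arctan K = 2 / Real.pi * Real.arctan K⁻¹ := by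
    rw [h2]
    field_simp
  rw [e, one_div]
  have h4 : 2 / Real.pi ≤ 1 := by
    rw [div_le_one (by linarith)]
    linarith
  calc 2 / Real.pi * Real.arctan K⁻¹ ≤ 2 / Real.pi * K⁻¹ :=
        mul_le_mul_of_nonneg_left h3 (by positivity)
    _ ≤ 1 * K⁻¹ := mul_le_mul_of_nonneg_right h4 (by positivity)
    _ = K⁻¹ := one_mul _

/-- The oscillation is bounded relative to the kernel itself, so the quadrature errors add up to a
multiple of `h · ∫ cauchyKernel ≤ h` rather than of `hK`. -/
theorem abs_cauchyKernel_sub_le {x y h : ℝ} (hxy : |x - y| ≤ h) (hh : h ≤ 1) :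
    |cauchyKernel x - cauchyKernel y| ≤ 2 * h * cauchyKernel x := by
  have hx : 0 < 1 + x ^ 2 := by positivity
  have hy : 0 < 1 + y ^ 2 := by positivity
  have e : cauchyKernel x - cauchyKernel y =
      cauchyKernel x * ((y - x) * ((x + y) / (1 + y ^ 2))) := by
    have := Real.pi_ne_zero
    unfold cauchyKernel
    field_simp
    ring
  have hsum : |(x + y) / (1 + y ^ 2)| ≤ 2 := by
    rw [abs_div, abs_of_pos hy, div_le_iff₀ hy]
    have h1 : |x + y| ≤ |x - y| + 2 * |y| := by
      have := abs_add_le (x - y) (2 * y)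
      rwa [abs_mul, abs_two, show x - y + 2 * y = x + y by ring] at this
    have h2 : 2 * |y| ≤ 1 + y ^ 2 := by
      rw [← sq_abs y]
      nlinarith [sq_nonneg (|y| - 1)]
    nlinarith [sq_nonneg y]
  rw [e, abs_mul, abs_of_pos (cauchyKernel_pos x), abs_mul, abs_sub_comm y x]
  have : |x - y| * |(x + y) / (1 + y ^ 2)| ≤ h * 2 :=
    mul_le_mul hxy hsum (abs_nonneg _) ((abs_nonneg _).trans hxy)
  nlinarith [cauchyKernel_pos x]

end Kernel

/-! ### Quadrature -/

section Quadrature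

variable {E : Type*} [NormedAddCommGroup E] [NormedSpace ℝ E]

theorem sum_trapezoid (M : ℕ) (hM : 1 ≤ M) (φ : ℕ → E) :
    ∑ j ∈ Finset.range (M + 1), (2 - if j = 0 ∨ j = M then (1 : ℝ) else 0) • φ j =
      ∑ j ∈ Finset.range M, (φ j + φ (j + 1)) := by
  have h1 : ∀ j, (2 - if j = 0 ∨ j = M then (1 : ℝ) else 0) • φ j =
      φ j + φ j - (if j = 0 then φ j else 0) - (if j = M then φ j else 0) := by
    intro j
    by_cases h0 : j = 0
    · have hM' : j ≠ M := by omega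
      rw [if_pos (Or.inl h0), if_pos h0, if_neg hM', sub_zero, ← two_smul ℝ, sub_smul, one_smul]
    · by_cases h2 : j = M
      · rw [if_pos (Or.inr h2), if_neg h0, if_pos h2, sub_zero, ← two_smul ℝ, sub_smul, one_smul]
      · rw [if_neg (by tauto), if_neg h0, if_neg h2, sub_zero, sub_zero, sub_zero, two_smul]
  simp only [h1, Finset.sum_sub_distrib, Finset.sum_add_distrib, Finset.sum_ite_eq',
    Finset.mem_range]
  rw [if_pos (by omega), if_pos (by omega)]
  conv_lhs => rw [Finset.sum_range_succ]
  have h2 : ∑ j ∈ Finset.range M, φ j + φ M = ∑ j ∈ Finset.range M, φ (j + 1) + φ 0 := by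
    rw [← Finset.sum_range_succ, Finset.sum_range_succ']
  calc _ = ∑ j ∈ Finset.range M, φ j + (∑ j ∈ Finset.range M, φ j + φ M) - φ 0 := by abel
    _ = _ := by rw [h2]; abel

/-- The error on one cell is the integral of the mean of the two endpoint values minus `φ x`. The
bound `g` depends on `x` so that it can be a multiple of the kernel. -/
theorem norm_trapezoid_sub_integral_le [CompleteSpace E] {φ : ℝ → E} {g : ℝ → ℝ} {a h : ℝ} (hh : 0 ≤ h)
    (hφ : Continuous φ) (hg : Continuous g)
    (hosc : ∀ x ∈ Set.Icc a (a + h), ∀ y ∈ Set.Icc a (a + h), ‖φ x - φ y‖ ≤ g x) :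
    ‖(h / 2) • (φ a + φ (a + h)) - ∫ x in a..(a + h), φ x‖ ≤ ∫ x in a..(a + h), g x := by
  have e : (h / 2) • (φ a + φ (a + h)) - ∫ x in a..(a + h), φ x =
      ∫ x in a..(a + h), ((1 / 2 : ℝ) • (φ a + φ (a + h)) - φ x) := by
    rw [intervalIntegral.integral_sub (by simp) (hφ.intervalIntegrable _ _),
      intervalIntegral.integral_const, smul_smul]
    congr 2
    ring
  rw [e]
  refine intervalIntegral.norm_integral_le_of_norm_le (by linarith)
    (Filter.Eventually.of_forall fun x hx => ?_) (hg.intervalIntegrable _ _)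
  have hx' : x ∈ Set.Icc a (a + h) := Set.Ioc_subset_Icc_self hx
  have h1 := hosc x hx' a (Set.left_mem_Icc.2 (by linarith))
  have h2 := hosc x hx' (a + h) (Set.right_mem_Icc.2 (by linarith))
  have e2 : (1 / 2 : ℝ) • (φ a + φ (a + h)) - φ x =
      -((1 / 2 : ℝ) • (φ x - φ a) + (1 / 2 : ℝ) • (φ x - φ (a + h))) := by
    module
  rw [e2, norm_neg]
  refine (norm_add_le _ _).trans ?_
  rw [norm_smul, norm_smul, Real.norm_of_nonneg (by norm_num)]
  linarith

/-- The error of the trapezoidal rule for a Lipschitz function against the Cauchy kernel. -/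
theorem norm_sum_coeff_smul_sub_integral_le [CompleteSpace E] {f : ℝ → E} {K b l : ℝ} {M : ℕ} (hK : 0 < K)
    (hM : 2 * K ≤ M) (hf : Continuous f) (hb : ∀ x ∈ Set.Icc (-K) K, ‖f x‖ ≤ b)
    (hl : ∀ x ∈ Set.Icc (-K) K, ∀ y ∈ Set.Icc (-K) K, ‖f x - f y‖ ≤ l * |x - y|) (hl0 : 0 ≤ l) :
    ‖∑ j, coeff K M j • f (node K M j) - ∫ x in (-K)..K, cauchyKernel x • f x‖ ≤
      2 * K / M * (l + 2 * b) := by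
  have hM0 : (0 : ℝ) < M := by linarith
  have hM1 : 1 ≤ M := by exact_mod_cast hM0
  set h := 2 * K / M with hh
  have hh0 : 0 < h := by positivity
  have hh1 : h ≤ 1 := (div_le_one hM0).2 hM
  have hb0 : 0 ≤ b := (norm_nonneg _).trans (hb 0 ⟨by linarith, hK.le⟩)
  let φ : ℝ → E := fun x => cauchyKernel x • f x
  have hφ : Continuous φ := continuous_cauchyKernel.smul hf
  let p : ℕ → ℝ := fun j => -K + j * h
  have hp0 : p 0 = -K := by simp [p]
  have hpM : p M = K := by
    simp only [p, hh]
    field_simp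
    ring
  have hps : ∀ j, p (j + 1) = p j + h := fun j => by
    simp only [p]
    push_cast
    ring
  have hpmem : ∀ j < M, Set.Icc (p j) (p j + h) ⊆ Set.Icc (-K) K := by
    intro j hj
    refine Set.Icc_subset_Icc ?_ ?_
    · simp only [p]
      have : 0 ≤ (j : ℝ) * h := by positivity
      linarith
    · rw [← hps, ← hpM]
      simp only [p]
      have : ((j + 1 : ℕ) : ℝ) * h ≤ M * h :=
        mul_le_mul_of_nonneg_right (by exact_mod_cast hj) hh0.le
      linarith
  have hsum : ∑ j, coeff K M j • f (node K M j) =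
      ∑ j ∈ Finset.range M, (h / 2) • (φ (p j) + φ (p j + h)) := by
    have e1 : ∀ j : Fin (M + 1), coeff K M j • f (node K M j) =
        (fun j : ℕ => (h / 2) • ((2 - if j = 0 ∨ j = M then (1 : ℝ) else 0) • φ (p j))) j := by
      intro j
      have e2 : node K M j = p j := by
        simp only [node, p, hh]
        ring
      simp only [φ]
      rw [coeff, e2, smul_smul, smul_smul, weight, cauchyKernel, hh]
      congr 1
      field_simp
    rw [Finset.sum_congr rfl fun j _ => e1 j,
      Fin.sum_univ_eq_sum_range (fun j : ℕ => (h / 2) • ((2 - if j = 0 ∨ j = M then (1 : ℝ) else 0) •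
        φ (p j))), ← Finset.smul_sum, sum_trapezoid M hM1 fun j => φ (p j), Finset.smul_sum]
    exact Finset.sum_congr rfl fun j _ => by rw [hps]
  have hint : ∫ x in (-K)..K, φ x = ∑ j ∈ Finset.range M, ∫ x in (p j)..(p j + h), φ x := by
    have := intervalIntegral.sum_integral_adjacent_intervals (a := p) (n := M)
      (μ := MeasureTheory.volume) (f := φ) fun j _ => hφ.intervalIntegrable _ _
    rw [hp0, hpM] at this
    rw [← this]
    exact Finset.sum_congr rfl fun j _ => by rw [hps]
  have hintg : ∫ x in (-K)..K, cauchyKernel x =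
      ∑ j ∈ Finset.range M, ∫ x in (p j)..(p j + h), cauchyKernel x := by
    have := intervalIntegral.sum_integral_adjacent_intervals (a := p) (n := M)
      (μ := MeasureTheory.volume) (f := cauchyKernel) fun j _ =>
        continuous_cauchyKernel.intervalIntegrable _ _
    rw [hp0, hpM] at this
    rw [← this]
    exact Finset.sum_congr rfl fun j _ => by rw [hps]
  -- Product rule: `h l` comes from the variation of `f`, `2 h b` from that of the kernel.
  have hosc : ∀ j < M, ∀ x ∈ Set.Icc (p j) (p j + h), ∀ y ∈ Set.Icc (p j) (p j + h),
      ‖φ x - φ y‖ ≤ h * (l + 2 * b) * cauchyKernel x := by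
    intro j hj x hx y hy
    have hxy : |x - y| ≤ h := by
      rw [abs_le]
      constructor <;> linarith [hx.1, hx.2, hy.1, hy.2]
    have e : φ x - φ y = cauchyKernel x • (f x - f y) +
        (cauchyKernel x - cauchyKernel y) • f y := by
      simp only [φ]
      module
    have h1 := hl x (hpmem j hj hx) y (hpmem j hj hy)
    have h2 := hb y (hpmem j hj hy)
    have h3 := abs_cauchyKernel_sub_le hxy hh1
    have h4 := cauchyKernel_pos x
    rw [e]
    refine (norm_add_le _ _).trans ?_
    rw [norm_smul, norm_smul, Real.norm_of_nonneg h4.le, Real.norm_eq_abs]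
    have h5 : ‖f x - f y‖ ≤ l * h := h1.trans (mul_le_mul_of_nonneg_left hxy hl0)
    have h6 : |cauchyKernel x - cauchyKernel y| * ‖f y‖ ≤ 2 * h * cauchyKernel x * b :=
      mul_le_mul h3 h2 (norm_nonneg _) (by positivity)
    have h7 := mul_le_mul_of_nonneg_left h5 h4.le
    linarith
  change ‖_ - ∫ x in (-K)..K, φ x‖ ≤ _
  rw [hsum, hint, ← Finset.sum_sub_distrib]
  calc ‖∑ j ∈ Finset.range M, ((h / 2) • (φ (p j) + φ (p j + h)) -
          ∫ x in (p j)..(p j + h), φ x)‖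
      ≤ ∑ j ∈ Finset.range M, ∫ x in (p j)..(p j + h), h * (l + 2 * b) * cauchyKernel x :=
        norm_sum_le_of_le _ fun j hj => norm_trapezoid_sub_integral_le hh0.le hφ
          (continuous_const.mul continuous_cauchyKernel) (hosc j (Finset.mem_range.1 hj))
    _ = h * (l + 2 * b) * ∫ x in (-K)..K, cauchyKernel x := by
        rw [hintg, Finset.mul_sum]
        exact Finset.sum_congr rfl fun j _ => intervalIntegral.integral_const_mul _ _
    _ ≤ h * (l + 2 * b) * 1 :=
        mul_le_mul_of_nonneg_left (integral_cauchyKernel_le_one K) (by positivity)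
    _ = _ := mul_one _

theorem abs_sum_coeff_sub_one_le {K : ℝ} {M : ℕ} (hK : 0 < K) (hM : 2 * K ≤ M) :
    |∑ j, coeff K M j - 1| ≤ 2 * (2 * K / M) + 1 / K := by
  have h1 := norm_sum_coeff_smul_sub_integral_le (E := ℝ) (f := fun _ => 1) (b := 1) (l := 0) hK hM
    continuous_const (by simp) (by simp) le_rfl
  simp only [smul_eq_mul, mul_one, Real.norm_eq_abs] at h1
  have h2 := one_sub_integral_cauchyKernel_le hK
  have := abs_sub_le (∑ j, coeff K M j) (∫ x in (-K)..K, cauchyKernel x) 1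
  linarith

theorem coeff_nonneg {K : ℝ} (hK : 0 < K) (M : ℕ) (j : Fin (M + 1)) : 0 ≤ coeff K M j := by
  unfold coeff weight
  have : (0 : ℝ) ≤ 2 - if (j : ℕ) = 0 ∨ (j : ℕ) = M then 1 else 0 := by
    split_ifs <;> norm_num
  positivity

theorem coeffNorm_eq_sum {K : ℝ} (hK : 0 < K) (M : ℕ) : coeffNorm K M = ∑ j, coeff K M j :=
  Finset.sum_congr rfl fun j _ => abs_of_nonneg (coeff_nonneg hK M j)

end Quadrature

/-! ### The contour integral -/

section Contour

variable {E : Type*} [NormedAddCommGroup E] [NormedSpace ℂ E] [CompleteSpace E]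

/-- Subtracting `F (-i)` cancels the pole of the kernel at `-i`, so Cauchy's theorem on the
rectangle below `[-K, K]` moves the integral to the other three sides. They have total length `4K`,
and the integrand there is at most `b / K²`. -/
theorem norm_integral_cauchyKernel_smul_sub_le {F : ℂ → E} (hF : Differentiable ℂ F) {K b : ℝ}
    (hK : 2 ≤ K) (hb : ∀ z : ℂ, |z.re| ≤ K → -K ≤ z.im → z.im ≤ 0 → ‖F z‖ ≤ b) :
    ‖∫ x in (-K)..K, cauchyKernel x • (F x - F (-Complex.I))‖ ≤ 4 * b / K := by
  have hpi := Real.pi_gt_three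
  have hb0 : 0 ≤ b := (norm_nonneg _).trans (hb 0 (by simp; linarith) (by simp; linarith) (by simp))
  -- Since `1 + z² = (z - i)(z + i)`, this is the integrand with its removable singularity at `-i`
  -- filled in by `dslope`; the pole at `i` lies outside the rectangle.
  let f : ℂ → E := fun z => ((Real.pi : ℂ) * (z - Complex.I))⁻¹ • dslope F (-Complex.I) z
  have hval : ∀ z : ℂ, z ≠ -Complex.I →
      f z = ((Real.pi : ℂ) * (1 + z ^ 2))⁻¹ • (F z - F (-Complex.I)) := by
    intro z hz
    simp only [f]
    rw [dslope_of_ne _ hz, slope_def_module, smul_smul, ← mul_inv]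
    congr 2
    linear_combination (-(Real.pi : ℂ)) * Complex.I_sq
  have hdiff : DifferentiableOn ℂ f {z | z.im < 1} := by
    have h1 : DifferentiableOn ℂ (dslope F (-Complex.I)) Set.univ :=
      (Complex.differentiableOn_dslope Filter.univ_mem).2 hF.differentiableOn
    refine DifferentiableOn.smul (DifferentiableOn.inv (by fun_prop) fun z hz => ?_)
      (h1.mono (Set.subset_univ _))
    refine mul_ne_zero (by exact_mod_cast Real.pi_ne_zero) (sub_ne_zero.2 ?_)
    rintro rfl
    simp at hz
  have hrect := Complex.integral_boundary_rect_eq_zero_of_differentiableOn f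
    (⟨-K, -K⟩ : ℂ) (⟨K, 0⟩ : ℂ) (hdiff.mono fun z hz => by
      have h2 := hz.2
      simp only [Set.mem_preimage, Set.uIcc_of_le (by linarith : -K ≤ 0)] at h2
      exact h2.2.trans_lt one_pos)
  simp only [Complex.ofReal_neg, Complex.ofReal_zero, zero_mul, add_zero] at hrect
  have hbound : ∀ z : ℂ, |z.re| ≤ K → -K ≤ z.im → z.im ≤ 0 → K ≤ ‖z‖ →
      ‖f z‖ ≤ b / K ^ 2 := by
    intro z h1 h2 h3 h4
    have hz : z ≠ -Complex.I := by
      rintro rfl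
      simp at h4
      linarith
    -- From `|z| ≥ K ≥ 2`. With `π > 3` the denominator exceeds `2K²`, which absorbs the bound `2b`
    -- of the numerator.
    have hz2 : 3 / 4 * K ^ 2 ≤ ‖1 + z ^ 2‖ := by
      have h5 : ‖z ^ 2‖ - ‖(1 : ℂ)‖ ≤ ‖z ^ 2 + 1‖ := by
        have := norm_sub_norm_le (z ^ 2) (-1)
        rwa [norm_neg, sub_neg_eq_add] at this
      rw [norm_pow, norm_one] at h5
      rw [add_comm]
      nlinarith
    have h6 : ‖F z - F (-Complex.I)‖ ≤ 2 * b := by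
      refine (norm_sub_le _ _).trans ?_
      have := hb z h1 h2 h3
      have := hb (-Complex.I) (by simp; linarith) (by simp; linarith) (by simp)
      linarith
    rw [hval z hz, norm_smul, norm_inv, norm_mul, Complex.norm_real,
      Real.norm_of_nonneg Real.pi_pos.le, inv_mul_eq_div]
    have hK2 : 0 < K ^ 2 := by positivity
    have h7 : 2 * K ^ 2 ≤ Real.pi * ‖1 + z ^ 2‖ := by nlinarith
    rw [div_le_div_iff₀ (by linarith) hK2]
    nlinarith
  have hbot : ‖∫ x : ℝ in (-K)..K, f (x + -K * Complex.I)‖ ≤ b / K ^ 2 * |K - -K| := by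
    refine intervalIntegral.norm_integral_le_of_norm_le_const fun x hx => ?_
    rw [Set.uIoc_of_le (by linarith)] at hx
    refine hbound _ ?_ (by simp) (by simp; linarith) ?_
    · simpa using abs_le.2 ⟨hx.1.le, hx.2⟩
    · have := Complex.abs_im_le_norm (x + -K * Complex.I)
      exact (le_abs_self K).trans (by simpa using this)
  have hside : ∀ c : ℝ, |c| = K →
      ‖∫ y : ℝ in (-K)..0, f (c + y * Complex.I)‖ ≤ b / K ^ 2 * |0 - -K| := by
    intro c hc
    refine intervalIntegral.norm_integral_le_of_norm_le_const fun y hy => ?_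
    rw [Set.uIoc_of_le (by linarith)] at hy
    refine hbound _ (by simp [hc]) (by simpa using hy.1.le) (by simpa using hy.2) ?_
    have := Complex.abs_re_le_norm (c + y * Complex.I)
    simpa [hc] using this
  have hr := hside K (abs_of_nonneg (by linarith))
  have hl := hside (-K) (by rw [abs_neg, abs_of_nonneg (by linarith)])
  have htop : ∫ x in (-K)..K, cauchyKernel x • (F x - F (-Complex.I)) =
      ∫ x : ℝ in (-K)..K, f x := by
    refine intervalIntegral.integral_congr fun x _ => ?_
    have hx : (x : ℂ) ≠ -Complex.I := fun h => by
      have := congrArg Complex.im h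
      simp at this
    change cauchyKernel x • (F x - F (-Complex.I)) = f x
    rw [hval x hx, cauchyKernel, ← Complex.coe_smul]
    push_cast
    rfl
  rw [htop]
  have hsolve : ∫ x : ℝ in (-K)..K, f x = (∫ x : ℝ in (-K)..K, f (x + -K * Complex.I)) +
      Complex.I • (∫ y : ℝ in (-K)..0, f (K + y * Complex.I)) -
      Complex.I • ∫ y : ℝ in (-K)..0, f ((-K : ℝ) + y * Complex.I) := by
    push_cast
    rw [← sub_eq_zero, ← neg_eq_zero, ← hrect]
    abel
  rw [hsolve]
  refine (norm_sub_le _ _).trans ((add_le_add_left (norm_add_le _ _) _).trans ?_)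
  rw [norm_smul, norm_smul, Complex.norm_I, one_mul, one_mul]
  refine (add_le_add (add_le_add hbot hr) hl).trans_eq ?_
  rw [abs_of_nonneg (by linarith : 0 ≤ K - -K), abs_of_nonneg (by linarith : 0 ≤ 0 - -K)]
  field_simp
  ring

end Contour

/-! ### The discretized integral representation of the solution -/

section Representation

variable {E : Type*} [NormedAddCommGroup E] [InnerProductSpace ℂ E]

/-- The real part of `⟨v, -i(H + κL)v⟩` is `Im κ · ⟨v, Lv⟩`. -/
theorem re_inner_generator_nonpos {H L : ℝ → E →L[ℂ] E} {κ : ℂ} (hκ : κ.im ≤ 0) {s : ℝ}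
    (hH : ∀ v, (inner ℂ v (H s v)).im = 0) (hL : ∀ v, (inner ℂ v (L s v)).im = 0)
    (hL0 : ∀ v, 0 ≤ (inner ℂ v (L s v)).re) (v : E) :
    (inner ℂ v (generator H L κ s v)).re ≤ 0 := by
  simp only [generator, smul_apply, add_apply,
    inner_smul_right, inner_add_right]
  simp only [neg_mul, Complex.neg_re, Complex.mul_re, Complex.mul_im, Complex.add_re,
    Complex.add_im, Complex.I_re, Complex.I_im, hH, hL]
  have := mul_nonpos_of_nonpos_of_nonneg hκ (hL0 v)
  linarith

theorem norm_generator_le {H L : ℝ → E →L[ℂ] E} {κ : ℂ} {s CH Λ R : ℝ} (hH : ‖H s‖ ≤ CH)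
    (hL : ‖L s‖ ≤ Λ) (hκ : ‖κ‖ ≤ R) : ‖generator H L κ s‖ ≤ CH + R * Λ := by
  rw [generator, norm_smul, norm_neg, Complex.norm_I, one_mul]
  refine (norm_add_le _ _).trans (add_le_add hH ?_)
  rw [norm_smul]
  exact mul_le_mul hκ hL (norm_nonneg _) ((norm_nonneg _).trans hκ)

/-- The solution of `y' = -(L + iH) y` is a combination of the solutions of
`y' = -i (H + kⱼ L) y`. -/
theorem norm_sum_coeff_smul_sub_le [CompleteSpace E] {H L : ℝ → E →L[ℂ] E} {t Λ K : ℝ} {M : ℕ} (ht : 0 ≤ t)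
    (hHc : ContinuousOn H (Set.Icc 0 t)) (hLc : ContinuousOn L (Set.Icc 0 t))
    (hH : ∀ s ∈ Set.Icc 0 t, ∀ v, (inner ℂ v (H s v)).im = 0)
    (hL : ∀ s ∈ Set.Icc 0 t, ∀ v, (inner ℂ v (L s v)).im = 0)
    (hL0 : ∀ s ∈ Set.Icc 0 t, ∀ v, 0 ≤ (inner ℂ v (L s v)).re)
    (hΛ : ∀ s ∈ Set.Icc 0 t, ‖L s‖ ≤ Λ) (hK : 2 ≤ K) (hM : (1 + Λ * t) * K ^ 2 ≤ M)
    {y : ℝ → E} {w : Fin (M + 1) → ℝ → E} (hy0 : ‖y 0‖ ≤ 1) (hw0 : ∀ j, w j 0 = y 0)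
    (hy : ∀ s ∈ Set.Icc 0 t,
      HasDerivWithinAt y (generator H L (-Complex.I) s (y s)) (Set.Icc 0 t) s)
    (hw : ∀ j, ∀ s ∈ Set.Icc 0 t,
      HasDerivWithinAt (w j) (generator H L (node K M j) s (w j s)) (Set.Icc 0 t) s) :
    ‖∑ j, coeff K M j • w j t - y t‖ ≤ 34 / K := by
  have hΛ0 : 0 ≤ Λ := (norm_nonneg _).trans (hΛ 0 ⟨le_rfl, ht⟩)
  have hΛt : 0 ≤ Λ * t := mul_nonneg hΛ0 ht
  have hK0 : 0 < K := by linarith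
  have hM2 : 2 * K ≤ M := by nlinarith
  have hM0 : (0 : ℝ) < M := by linarith
  obtain ⟨CH, hCH⟩ := isCompact_Icc.exists_bound_of_continuousOn hHc
  set C := CH + 2 * K * Λ with hC
  have hgc : ∀ κ : ℂ, ContinuousOn (generator H L κ) (Set.Icc 0 t) := fun κ =>
    (hHc.add (hLc.const_smul κ)).const_smul (-Complex.I)
  -- It suffices to prove the bound for Euler iterates with all large `n`.
  have hlim : Filter.Tendsto (fun n : ℕ =>
      ‖∑ j, coeff K M j • euler (generator H L (node K M j)) (t / n) (y 0) n -
        euler (generator H L (-Complex.I)) (t / n) (y 0) n‖) Filter.atTop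
      (nhds ‖∑ j, coeff K M j • w j t - y t‖) := by
    refine ((tendsto_finsetSum _ fun j _ => Filter.Tendsto.const_smul ?_ _).sub
      (tendsto_euler ht (hgc _) hy)).norm
    rw [← hw0 j]
    exact tendsto_euler ht (hgc _) (hw j)
  refine le_of_tendsto hlim ?_
  have hev : ∀ᶠ n : ℕ in Filter.atTop, 2 * (t ^ 2 * C ^ 2) + 1 ≤ (n : ℝ) :=
    tendsto_natCast_atTop_atTop.eventually_ge_atTop _
  filter_upwards [hev] with n hn
  have hn0 : (0 : ℝ) < n := by
    have : 0 ≤ t ^ 2 * C ^ 2 := by positivity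
    linarith
  set Δ := t / n with hΔ
  have hΔ0 : 0 ≤ Δ := by positivity
  have hnΔ : (n : ℝ) * Δ = t := by
    rw [hΔ]
    field_simp
  have hmem : ∀ i < n, (i : ℝ) * Δ ∈ Set.Icc 0 t := fun i hi =>
    ⟨by positivity, by
      rw [← hnΔ]
      exact mul_le_mul_of_nonneg_right (by exact_mod_cast hi.le) hΔ0⟩
  -- For large `n` the accumulated growth is at most `exp (1/2)`, so `F` is bounded by 2 on the
  -- rectangle, where `‖κ‖ ≤ 2K`.
  have hρ : (1 + Δ ^ 2 * C ^ 2) ^ n ≤ 2 := by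
    refine (one_add_pow_le_exp (by positivity) n).trans ?_
    have h1 : (n : ℝ) * (Δ ^ 2 * C ^ 2) ≤ 1 / 2 := by
      have : (n : ℝ) * (Δ ^ 2 * C ^ 2) = t ^ 2 * C ^ 2 / n := by
        rw [hΔ]
        field_simp
      rw [this, div_le_iff₀ hn0]
      linarith
    refine (Real.exp_le_exp.2 h1).trans ?_
    have h2 : Real.exp (1 / 2) ^ 2 ≤ 2 ^ 2 := by
      rw [← Real.exp_nat_mul]
      norm_num
      linarith [Real.exp_one_lt_d9]
    exact (abs_le_of_sq_le_sq' h2 (by norm_num)).2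
  have hCn : ∀ κ : ℂ, ‖κ‖ ≤ 2 * K → ∀ i < n, ‖generator H L κ (i * Δ)‖ ≤ C := fun κ hκ i hi =>
    norm_generator_le (hCH _ (hmem i hi)) (hΛ _ (hmem i hi)) hκ
  have hdn : ∀ κ : ℂ, κ.im ≤ 0 → ∀ i < n, ∀ v,
      (inner ℂ v (generator H L κ (i * Δ) v)).re ≤ 0 := fun κ hκ i hi v =>
    re_inner_generator_nonpos hκ (hH _ (hmem i hi)) (hL _ (hmem i hi)) (hL0 _ (hmem i hi)) v
  let F : ℂ → E := fun κ => euler (generator H L κ) Δ (y 0) n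
  have hFd : Differentiable ℂ F := differentiable_euler H L Δ (y 0) n
  have hFb : ∀ z : ℂ, |z.re| ≤ K → -K ≤ z.im → z.im ≤ 0 → ‖F z‖ ≤ 2 := by
    intro z h1 h2 h3
    have hz : ‖z‖ ≤ 2 * K := by
      refine (Complex.norm_le_abs_re_add_abs_im z).trans ?_
      rw [abs_of_nonpos h3]
      linarith
    refine (norm_euler_le hΔ0 (hCn z hz) (hdn z h3) (y 0) n le_rfl).trans ?_
    have := mul_le_mul hρ hy0 (norm_nonneg _) (by norm_num)
    linarith
  have hFI : ‖F (-Complex.I)‖ ≤ 2 := hFb _ (by simp; linarith) (by simp; linarith) (by simp)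
  have hFl : ∀ x ∈ Set.Icc (-K) K, ∀ x' ∈ Set.Icc (-K) K,
      ‖F (x : ℂ) - F (x' : ℂ)‖ ≤ 2 * (Λ * t) * |x - x'| := by
    intro x hx x' hx'
    have hnorm : ∀ x ∈ Set.Icc (-K) K, ‖(x : ℂ)‖ ≤ 2 * K := fun x hx => by
      rw [Complex.norm_real]
      exact (abs_le.2 hx).trans (by linarith)
    have := norm_euler_sub_euler_le hΔ0 (fun i hi => hΛ _ (hmem i hi)) (hCn x (hnorm x hx))
      (hCn x' (hnorm x' hx')) (hdn x (by simp)) (hdn x' (by simp)) (y 0) n le_rfl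
    refine this.trans ?_
    rw [hnΔ, ← Complex.ofReal_sub, Complex.norm_real, Real.norm_eq_abs]
    have h1 : t * Λ * |x - x'| * (1 + Δ ^ 2 * C ^ 2) ^ n * ‖y 0‖ ≤ t * Λ * |x - x'| * 2 * 1 := by
      gcongr
    linarith
  have hquad := norm_sum_coeff_smul_sub_integral_le (f := fun x : ℝ => F x - F (-Complex.I))
    (b := 4) (l := 2 * (Λ * t)) hK0 hM2
    ((hFd.continuous.comp Complex.continuous_ofReal).sub continuous_const)
    (fun x hx => by
      have := hFb x (by simpa using abs_le.2 hx) (by simp; linarith) (by simp)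
      linarith [norm_sub_le (F x) (F (-Complex.I))])
    (fun x hx x' hx' => by
      rw [sub_sub_sub_cancel_right]
      exact hFl x hx x' hx') (by positivity)
  have hcont := norm_integral_cauchyKernel_smul_sub_le hFd hK hFb
  have hsum := abs_sum_coeff_sub_one_le hK0 hM2
  -- Three errors: quadrature, the contour integral, and the defect of `∑ cⱼ` from one.
  have e : ∑ j, coeff K M j • F (node K M j) - F (-Complex.I) =
      (∑ j, coeff K M j • (F (node K M j) - F (-Complex.I)) -
        ∫ x in (-K)..K, cauchyKernel x • (F x - F (-Complex.I))) +
      (∫ x in (-K)..K, cauchyKernel x • (F x - F (-Complex.I))) +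
      (∑ j, coeff K M j - 1) • F (-Complex.I) := by
    simp only [smul_sub, Finset.sum_sub_distrib, sub_smul, one_smul, Finset.sum_smul]
    abel
  change ‖∑ j, coeff K M j • F (node K M j) - F (-Complex.I)‖ ≤ _
  rw [e]
  refine (norm_add₃_le).trans ?_
  rw [norm_smul, Real.norm_eq_abs]
  have h3 : |∑ j, coeff K M j - 1| * ‖F (-Complex.I)‖ ≤ (2 * (2 * K / M) + 1 / K) * 2 :=
    mul_le_mul hsum hFI (norm_nonneg _) ((abs_nonneg _).trans hsum)
  have hhb : 2 * K / M * (1 + Λ * t) ≤ 2 / K := by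
    rw [div_mul_eq_mul_div, div_le_div_iff₀ hM0 hK0]
    linarith
  have hh0 : 0 ≤ 2 * K / M := by positivity
  have h4 : 2 * K / M * (2 * (Λ * t) + 2 * 4) + (2 * (2 * K / M)) * 2 ≤ 12 * (2 / K) := by
    nlinarith [mul_nonneg hh0 hΛt]
  -- In order: all discretization errors, the contour, and the tail of the kernel times `‖F (-i)‖ ≤
  -- 2`.
  have e5 : 34 / K = 12 * (2 / K) + 4 * 2 / K + 1 / K * 2 := by ring
  rw [e5]
  linarith

end Representation

/-! ### The differential equation in Euclidean space -/

section Matrices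

variable {N : ℕ}

theorem hermPart_isHermitian (A : Matrix (Fin N) (Fin N) ℂ) : (hermPart A).IsHermitian := by
  rw [Matrix.IsHermitian, hermPart, Matrix.conjTranspose_smul, Matrix.conjTranspose_add,
    Matrix.conjTranspose_conjTranspose, add_comm Aᴴ]
  simp

theorem antiHermPart_isHermitian (A : Matrix (Fin N) (Fin N) ℂ) :
    (antiHermPart A).IsHermitian := by
  rw [Matrix.IsHermitian, antiHermPart, Matrix.conjTranspose_smul, Matrix.conjTranspose_sub,
    Matrix.conjTranspose_conjTranspose, ← neg_sub A, smul_neg, ← neg_smul]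
  congr 1
  simp

/-- At `κ = -i` the generator is that of the original equation, which is why `u` is the value at the
pole of the kernel. -/
theorem neg_I_smul_parts (A : Matrix (Fin N) (Fin N) ℂ) :
    -Complex.I • (antiHermPart A + -Complex.I • hermPart A) = -A := by
  have h1 : -Complex.I * (1 / (2 * Complex.I)) = -(1 / 2) := by
    have := Complex.I_ne_zero
    field_simp
  rw [smul_add, antiHermPart, hermPart, smul_smul, smul_smul, smul_smul, h1]
  have h2 : -Complex.I * -Complex.I = -1 := by
    rw [neg_mul_neg, Complex.I_mul_I]
  rw [h2]
  module

theorem inner_toEuclideanCLM_apply (B : Matrix (Fin N) (Fin N) ℂ) (x y : Fin N → ℂ) :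
    inner ℂ (WithLp.toLp 2 x) (Matrix.toEuclideanCLM (n := Fin N) (𝕜 := ℂ) B (WithLp.toLp 2 y)) =
      star x ⬝ᵥ (B *ᵥ y) := by
  rw [Matrix.toEuclideanCLM_toLp, EuclideanSpace.inner_toLp_toLp, dotProduct_comm]

theorem continuous_toEuclideanCLM :
    Continuous (Matrix.toEuclideanCLM (n := Fin N) (𝕜 := ℂ)) :=
  (Matrix.toEuclideanCLM (n := Fin N) (𝕜 := ℂ)).toAlgEquiv.toLinearMap.continuous_of_finiteDimensional

theorem hasDerivWithinAt_toLp {u : ℝ → Fin N → ℂ} {u' : Fin N → ℂ} {s : Set ℝ} {r : ℝ}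
    (h : HasDerivWithinAt u u' s r) :
    HasDerivWithinAt (fun r => WithLp.toLp 2 (u r) : ℝ → EuclideanSpace ℂ (Fin N))
      (WithLp.toLp 2 u') s r :=
  (PiLp.continuousLinearEquiv 2 ℝ
    fun _ : Fin N => ℂ).symm.toContinuousLinearMap.hasFDerivAt.comp_hasDerivWithinAt r h

/-- The state `u t` is approximated by the combination of the unitary evolutions. -/
theorem norm_sum_coeff_smul_propagator_sub_le {T t Λ K : ℝ} {M : ℕ}
    {A : ℝ → Matrix (Fin N) (Fin N) ℂ} {u : ℝ → Fin N → ℂ}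
    {U : Fin (M + 1) → ℝ → Matrix (Fin N) (Fin N) ℂ} (ht : t ∈ Set.Icc 0 T)
    (hA : ContinuousOn A (Set.Icc 0 T)) (hL : ∀ s ∈ Set.Icc 0 T, (hermPart (A s)).PosSemidef)
    (hΛ : ∀ s ∈ Set.Icc 0 T, ‖hermPart (A s)‖ ≤ Λ) (hu : IsSolution T A u) (hK : 2 ≤ K)
    (hM : (1 + Λ * T) * K ^ 2 ≤ M) (hU : ∀ j, IsPropagator T A (node K M j) (U j))
    (hu0 : ‖(WithLp.toLp 2 (u 0) : EuclideanSpace ℂ (Fin N))‖ ≤ 1) :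
    ‖∑ j, coeff K M j • (WithLp.toLp 2 (U j t *ᵥ u 0) : EuclideanSpace ℂ (Fin N)) -
      WithLp.toLp 2 (u t)‖ ≤ 34 / K := by
  have hsub : Set.Icc 0 t ⊆ Set.Icc 0 T := Set.Icc_subset_Icc_right ht.2
  have hΛ0 : 0 ≤ Λ := (norm_nonneg _).trans (hΛ 0 ⟨le_rfl, ht.1.trans ht.2⟩)
  have hgen : ∀ (κ : ℂ) (s : ℝ) (x : Fin N → ℂ),
      generator (fun s => Matrix.toEuclideanCLM (n := Fin N) (𝕜 := ℂ) (antiHermPart (A s)))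
        (fun s => Matrix.toEuclideanCLM (n := Fin N) (𝕜 := ℂ) (hermPart (A s))) κ s
        (WithLp.toLp 2 x) =
      WithLp.toLp 2 ((-Complex.I • (antiHermPart (A s) + κ • hermPart (A s))) *ᵥ x) := by
    intro κ s x
    rw [generator, ← map_smul, ← map_add, ← map_smul, Matrix.toEuclideanCLM_toLp]
  refine norm_sum_coeff_smul_sub_le
    (H := fun s => Matrix.toEuclideanCLM (n := Fin N) (𝕜 := ℂ) (antiHermPart (A s)))
    (L := fun s => Matrix.toEuclideanCLM (n := Fin N) (𝕜 := ℂ) (hermPart (A s))) (Λ := Λ)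
    (y := fun s => WithLp.toLp 2 (u s)) (w := fun j s => WithLp.toLp 2 (U j s *ᵥ u 0))
    ht.1 ?_ ?_ ?_ ?_ ?_ ?_ hK ?_ hu0 ?_ ?_ ?_
  · have : Continuous fun B : Matrix (Fin N) (Fin N) ℂ => antiHermPart B := by
      unfold antiHermPart
      fun_prop
    exact (continuous_toEuclideanCLM.comp this).comp_continuousOn (hA.mono hsub)
  · have : Continuous fun B : Matrix (Fin N) (Fin N) ℂ => hermPart B := by
      unfold hermPart
      fun_prop
    exact (continuous_toEuclideanCLM.comp this).comp_continuousOn (hA.mono hsub)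
  · intro s _ v
    obtain ⟨x, rfl⟩ := WithLp.toLp_surjective 2 v
    rw [inner_toEuclideanCLM_apply]
    exact (antiHermPart_isHermitian (A s)).im_star_dotProduct_mulVec_self x
  · intro s _ v
    obtain ⟨x, rfl⟩ := WithLp.toLp_surjective 2 v
    rw [inner_toEuclideanCLM_apply]
    exact (hermPart_isHermitian (A s)).im_star_dotProduct_mulVec_self x
  · intro s hs v
    obtain ⟨x, rfl⟩ := WithLp.toLp_surjective 2 v
    rw [inner_toEuclideanCLM_apply]
    exact (hL s (hsub hs)).re_dotProduct_nonneg x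
  · intro s hs
    rw [Matrix.l2_opNorm_toEuclideanCLM]
    exact hΛ s (hsub hs)
  · refine le_trans (mul_le_mul_of_nonneg_right ?_ (sq_nonneg K)) hM
    have := mul_le_mul_of_nonneg_left ht.2 hΛ0
    linarith
  · intro j
    simp only [(hU j).1, Matrix.one_mulVec]
  · intro s hs
    rw [hgen, neg_I_smul_parts, Matrix.neg_mulVec]
    exact hasDerivWithinAt_toLp ((hu s (hsub hs)).mono hsub)
  · intro j s hs
    rw [hgen]
    refine hasDerivWithinAt_toLp (hasDerivWithinAt_pi.2 fun a => ?_)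
    rw [Matrix.mulVec_mulVec, Matrix.smul_mul]
    simp only [Matrix.mulVec, dotProduct]
    exact HasDerivWithinAt.fun_sum fun b _ =>
      (((hU j).2 s (hsub hs) a b).mono hsub).mul_const (u 0 b)

end Matrices

/-! ### Perturbation of the quadratic form -/

section Form

variable {E : Type*} [NormedAddCommGroup E] [InnerProductSpace ℂ E]

theorem norm_inner_apply_sub_le {B : E →L[ℂ] E} {β : ℝ} (hB : ‖B‖ ≤ β) (v v' w w' : E) :
    ‖inner ℂ v (B v') - inner ℂ w (B w')‖ ≤ β * (‖v - w‖ * ‖v'‖ + ‖w‖ * ‖v' - w'‖) := by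
  have hβ : 0 ≤ β := (norm_nonneg _).trans hB
  have key : ∀ x y : E, ‖inner ℂ x (B y)‖ ≤ β * (‖x‖ * ‖y‖) := fun x y => by
    refine (norm_inner_le_norm _ _).trans ?_
    have := mul_le_mul_of_nonneg_left (B.le_of_opNorm_le hB y) (norm_nonneg x)
    linarith
  have e : inner ℂ v (B v') - inner ℂ w (B w') =
      inner ℂ (v - w) (B v') + inner ℂ w (B (v' - w')) := by
    rw [map_sub, inner_sub_left, inner_sub_right]
    ring
  rw [e, mul_add]
  exact (norm_add_le _ _).trans (add_le_add (key _ _) (key _ _))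

theorem sum_sum_mul_inner_eq {ι : Type*} [Fintype ι] (B : E →L[ℂ] E) (c : ι → ℝ) (v : ι → E) :
    ∑ j, ∑ j', ((c j * c j' : ℝ) : ℂ) * inner ℂ (v j) (B (v j')) =
      inner ℂ (∑ j, c j • v j) (B (∑ j, c j • v j)) := by
  rw [sum_inner]
  refine Finset.sum_congr rfl fun j _ => ?_
  rw [map_sum, inner_sum]
  refine Finset.sum_congr rfl fun j' _ => ?_
  rw [← Complex.coe_smul, ← Complex.coe_smul, map_smul, inner_smul_left, inner_smul_right,
    Complex.conj_ofReal]
  push_cast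
  ring

end Form

/-! ### The Monte Carlo estimate -/

section MonteCarlo

variable {S : Type} [Fintype S] {p : S → ℝ}

theorem norm_sum_weight_mul_le (hp : IsProbWeight p) {Z : S → ℂ} {β : ℝ} (hZ : ∀ x, ‖Z x‖ ≤ β) :
    ‖∑ x, (p x : ℂ) * Z x‖ ≤ β := by
  refine (norm_sum_le _ _).trans ?_
  calc ∑ x, ‖(p x : ℂ) * Z x‖ ≤ ∑ x, p x * β := by
        refine Finset.sum_le_sum fun x _ => ?_
        rw [norm_mul, Complex.norm_real, Real.norm_of_nonneg (hp.nonneg x)]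
        exact mul_le_mul_of_nonneg_left (hZ x) (hp.nonneg x)
    _ = β := by rw [← Finset.sum_mul, hp.sum_eq_one, one_mul]

/-- The mean of independent estimates `Y` of a bounded random variable `Z` is close to the
expectation of `Z`. -/
theorem eventProb_mean_sub_le (hp : IsProbWeight p) {Y Z : S → ℂ} {β η τ γ : ℝ} (hβ : 0 < β)
    (hτ : 0 < τ) (hZ : ∀ x, ‖Z x‖ ≤ β)
    (hY : 1 - γ ≤ eventProb p {x | ‖Y x - Z x‖ ≤ η}) {J : ℕ} (hJ : 0 < J) :
    1 - (J * γ + 4 * Real.exp (-(J * τ ^ 2 / (8 * β ^ 2)))) ≤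
      eventProb (fun ω : Fin J → S => ∏ j, p (ω j))
        {ω | ‖(∑ j, Y (ω j)) / (J : ℂ) - ∑ x, (p x : ℂ) * Z x‖ ≤ η + 2 * τ} := by
  set μ := ∑ x, (p x : ℂ) * Z x with hμ
  set W := fun ω : Fin J → S => ∏ j, p (ω j)
  have hw : IsProbWeight W := IsProbWeight.pi fun _ => hp
  have hμβ : ‖μ‖ ≤ β := norm_sum_weight_mul_le hp hZ
  have hzero : ∑ x, (p x : ℂ) * (Z x - μ) = 0 := by
    simp only [mul_sub, Finset.sum_sub_distrib, ← Finset.sum_mul, ← hμ]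
    rw [← Complex.ofReal_sum, hp.sum_eq_one]
    simp
  have hdev : ∀ x, ‖Z x - μ‖ ≤ 2 * β := fun x =>
    (norm_sub_le _ _).trans (by linarith [hZ x])
  have hre : ∑ x, p x * (Z x - μ).re = 0 := by
    have := congrArg Complex.re hzero
    simpa [Complex.re_sum] using this
  have him : ∑ x, p x * (Z x - μ).im = 0 := by
    have := congrArg Complex.im hzero
    simpa [Complex.im_sum] using this
  have hexp : (2 : ℝ) * (2 * β) ^ 2 = 8 * β ^ 2 := by ring
  -- Hoeffding is applied to the exact values `Z`. The estimates `Y` need be neither bounded nor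
  -- unbiased; they enter only through the union bound for `E3`.
  have h1 := eventProb_abs_sum_ge_le (ι := Fin J) (p := fun _ => p) (fun _ => hp) Finset.univ
    (X := fun _ x => (Z x - μ).re) (by linarith : 0 < 2 * β) hτ
    (fun _ _ x => (Complex.abs_re_le_norm _).trans (hdev x)) (fun _ _ => hre)
  have h2 := eventProb_abs_sum_ge_le (ι := Fin J) (p := fun _ => p) (fun _ => hp) Finset.univ
    (X := fun _ x => (Z x - μ).im) (by linarith : 0 < 2 * β) hτ
    (fun _ _ x => (Complex.abs_im_le_norm _).trans (hdev x)) (fun _ _ => him)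
  rw [Finset.card_univ, Fintype.card_fin, hexp] at h1 h2
  set E1 : Set (Fin J → S) := {ω | J * τ ≤ |∑ j, (Z (ω j) - μ).re|} with hE1
  set E2 : Set (Fin J → S) := {ω | J * τ ≤ |∑ j, (Z (ω j) - μ).im|} with hE2
  have h3 : eventProb W (⋃ j, {ω | ω j ∈ {x | ‖Y x - Z x‖ ≤ η}ᶜ}) ≤ J * γ := by
    refine (eventProb_iUnion_le hw _).trans ?_
    calc ∑ j : Fin J, eventProb W {ω | ω j ∈ {x | ‖Y x - Z x‖ ≤ η}ᶜ} ≤ ∑ _j : Fin J, γ := by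
          refine Finset.sum_le_sum fun j _ => ?_
          rw [eventProb_pi_eval (p := fun _ : Fin J => p) (fun _ => hp) j, eventProb_compl hp]
          linarith
      _ = J * γ := by simp
  set E3 : Set (Fin J → S) := ⋃ j, {ω | ω j ∈ {x | ‖Y x - Z x‖ ≤ η}ᶜ} with hE3
  have hbad : eventProb W (E3 ∪ (E1 ∪ E2)) ≤
      J * γ + 4 * Real.exp (-(J * τ ^ 2 / (8 * β ^ 2))) := by
    refine (eventProb_union_le hw _ _).trans ?_
    have := eventProb_union_le hw E1 E2
    linarith
  have hgood : 1 - (J * γ + 4 * Real.exp (-(J * τ ^ 2 / (8 * β ^ 2)))) ≤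
      eventProb W (E3 ∪ (E1 ∪ E2))ᶜ := by
    rw [eventProb_compl hw]
    linarith
  refine hgood.trans (eventProb_mono hw fun ω hω => ?_)
  have hJ0 : (0 : ℝ) < J := by exact_mod_cast hJ
  have hJc : (J : ℂ) ≠ 0 := by exact_mod_cast hJ.ne'
  simp only [Set.mem_compl_iff, Set.mem_union, not_or] at hω
  obtain ⟨hω3, hω1, hω2⟩ := hω
  simp only [hE3, Set.mem_iUnion, not_exists, Set.mem_ofPred_eq, Set.mem_compl_iff,
    not_not] at hω3
  simp only [hE1, hE2, Set.mem_ofPred_eq, not_le] at hω1 hω2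
  have e : (∑ j, Y (ω j)) / (J : ℂ) - μ =
      ((∑ j, (Y (ω j) - Z (ω j))) + ∑ j, (Z (ω j) - μ)) / (J : ℂ) := by
    rw [← Finset.sum_add_distrib]
    simp only [sub_add_sub_cancel, Finset.sum_sub_distrib, Finset.sum_const, Finset.card_univ,
      Fintype.card_fin, nsmul_eq_mul]
    field_simp
  change ‖(∑ j, Y (ω j)) / (J : ℂ) - μ‖ ≤ _
  rw [e, norm_div, Complex.norm_natCast, div_le_iff₀ hJ0]
  refine (norm_add_le _ _).trans ?_
  have h4 : ‖∑ j, (Y (ω j) - Z (ω j))‖ ≤ J * η := by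
    refine (norm_sum_le_of_le _ fun j _ => hω3 j).trans_eq ?_
    simp
  have h5 := Complex.norm_le_abs_re_add_abs_im (∑ j, (Z (ω j) - μ))
  rw [Complex.re_sum, Complex.im_sum] at h5
  nlinarith

end MonteCarlo

section Sampling

variable {m N : ℕ} [NeZero N] {P : Estimator m N} {K : ℝ} {M : ℕ}
  {prep : Matrix.unitaryGroup (Fin N) ℂ} {obs : Matrix.unitaryGroup (OracleBasis m N) ℂ}
  {W : Fin (M + 1) → Matrix.unitaryGroup (Fin N) ℂ}

theorem sum_coeff_mul_coeff_div (hK : 0 < K) (hc : 0 < coeffNorm K M) :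
    ∑ x : Fin (M + 1) × Fin (M + 1), coeff K M x.1 * coeff K M x.2 / coeffNorm K M ^ 2 = 1 := by
  rw [← Finset.sum_div, Fintype.sum_prod_type, ← Finset.sum_mul_sum, ← coeffNorm_eq_sum hK, sq]
  exact div_self (mul_pos hc hc).ne'

theorem sampleProb_isProbWeight (hK : 0 < K) (hc : 0 < coeffNorm K M) :
    IsProbWeight (sampleProb P K M prep obs W) where
  nonneg x := mul_nonneg
    (div_nonneg (mul_nonneg (coeff_nonneg hK M _) (coeff_nonneg hK M _)) (sq_nonneg _))
    ((P.prob_isProbWeight _).nonneg _)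
  sum_eq_one := by
    rw [Fintype.sum_prod_type, ← sum_coeff_mul_coeff_div hK hc]
    refine Finset.sum_congr rfl fun x _ => ?_
    simp only [sampleProb]
    rw [← Finset.mul_sum, (P.prob_isProbWeight _).sum_eq_one, mul_one]

theorem le_eventProb_sampleProb (hK : 0 < K) (hc : 0 < coeffNorm K M) {E : Set (Sample P M)}
    {q : ℝ} (h : ∀ k k', q ≤ eventProb (P.prob (pairOracles prep obs W k k'))
      {z | ((k, k'), z) ∈ E}) : q ≤ eventProb (sampleProb P K M prep obs W) E := by
  classical
  have e : eventProb (sampleProb P K M prep obs W) E =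
      ∑ x : Fin (M + 1) × Fin (M + 1), coeff K M x.1 * coeff K M x.2 / coeffNorm K M ^ 2 *
        eventProb (P.prob (pairOracles prep obs W x.1 x.2)) {z | (x, z) ∈ E} := by
    unfold eventProb
    rw [Fintype.sum_prod_type]
    refine Finset.sum_congr rfl fun x _ => ?_
    rw [Finset.mul_sum]
    refine Finset.sum_congr rfl fun z _ => ?_
    by_cases hz : (x, z) ∈ E
    · rw [if_pos hz, if_pos (show z ∈ {z | (x, z) ∈ E} from hz)]
      rfl
    · rw [if_neg hz, if_neg (show z ∉ {z | (x, z) ∈ E} from hz), mul_zero]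
  rw [e]
  calc q = ∑ x : Fin (M + 1) × Fin (M + 1),
        coeff K M x.1 * coeff K M x.2 / coeffNorm K M ^ 2 * q := by
        rw [← Finset.sum_mul, sum_coeff_mul_coeff_div hK hc, one_mul]
    _ ≤ _ := Finset.sum_le_sum fun x _ => mul_le_mul_of_nonneg_left (h x.1 x.2)
        (div_nonneg (mul_nonneg (coeff_nonneg hK M _) (coeff_nonneg hK M _)) (sq_nonneg _))

theorem sum_sampleProb_mul (Z : Fin (M + 1) → Fin (M + 1) → ℂ) :
    ∑ x : Sample P M, (sampleProb P K M prep obs W x : ℂ) * Z x.1.1 x.1.2 =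
      (∑ k, ∑ k', ((coeff K M k * coeff K M k' : ℝ) : ℂ) * Z k k') /
        (coeffNorm K M : ℂ) ^ 2 := by
  rw [Fintype.sum_prod_type, Fintype.sum_prod_type, Finset.sum_div]
  refine Finset.sum_congr rfl fun k _ => ?_
  rw [Finset.sum_div]
  refine Finset.sum_congr rfl fun k' _ => ?_
  simp only [sampleProb]
  rw [← Finset.sum_mul, ← Complex.ofReal_sum, ← Finset.mul_sum, (P.prob_isProbWeight _).sum_eq_one]
  push_cast
  ring

end Sampling

/-! ### The choice of the parameters -/

theorem log_one_div_ge {δ : ℝ} (hδ : 0 < δ) (hδ' : δ ≤ 1 / 2) : 69 / 100 ≤ Real.log (1 / δ) := by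
  have h2 : 2 ≤ 1 / δ := by
    rw [le_div_iff₀ hδ]
    linarith
  have := Real.log_le_log (by norm_num) h2
  linarith [Real.log_two_gt_d9]

theorem four_le_sq_div_sq {β ε : ℝ} (hε : 0 < ε) (hβ : ε ≤ β / 2) : 4 ≤ β ^ 2 / ε ^ 2 := by
  rw [le_div_iff₀ (by positivity)]
  nlinarith

/-- `51200 = 4 · 8 · 40²` makes the exponent at least `4 log (1/δ)`, and `4δ⁴ ≤ δ/2`. Rounding up
costs at most one more unit of `β²/ε² · log (1/δ) ≥ 1`. -/
theorem exists_sampleCount {β ε δ : ℝ} (hε : 0 < ε) (hβ : ε ≤ β / 2) (hδ : 0 < δ)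
    (hδ' : δ ≤ 1 / 2) :
    ∃ J : ℕ, 0 < J ∧ (J : ℝ) ≤ 51201 * (β ^ 2 / ε ^ 2 * Real.log (1 / δ)) ∧
      4 * Real.exp (-(J * (ε / 40) ^ 2 / (8 * β ^ 2))) ≤ δ / 2 := by
  have hβ0 : 0 < β := by linarith
  set l := Real.log (1 / δ) with hl
  have hl2 : 69 / 100 ≤ l := log_one_div_ge hδ hδ'
  have hrl : 1 ≤ β ^ 2 / ε ^ 2 * l := by
    have := mul_le_mul (four_le_sq_div_sq hε hβ) hl2 (by norm_num) (by positivity)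
    linarith
  have hJge := Nat.le_ceil (51200 * (β ^ 2 / ε ^ 2 * l))
  have hJle := Nat.ceil_lt_add_one (a := 51200 * (β ^ 2 / ε ^ 2 * l)) (by linarith)
  generalize ⌈51200 * (β ^ 2 / ε ^ 2 * l)⌉₊ = J at hJge hJle
  have hJ0 : (0 : ℝ) < J := by linarith
  refine ⟨J, by exact_mod_cast hJ0, by linarith, ?_⟩
  have h1 : 4 * l ≤ J * (ε / 40) ^ 2 / (8 * β ^ 2) := by
    rw [le_div_iff₀ (by positivity)]
    have h2 := mul_le_mul_of_nonneg_right hJge (by positivity : 0 ≤ (ε / 40) ^ 2)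
    refine le_trans (le_of_eq ?_) h2
    field_simp
    ring
  have h3 : Real.exp (-(J * (ε / 40) ^ 2 / (8 * β ^ 2))) ≤ δ ^ 4 := by
    refine (Real.exp_le_exp.2 (neg_le_neg h1)).trans_eq ?_
    rw [hl, one_div, Real.log_inv, mul_neg, neg_neg]
    have := Real.exp_nat_mul (Real.log δ) 4
    rw [Real.exp_log hδ] at this
    exact_mod_cast this
  have h4 : δ ^ 3 * δ ≤ (1 / 2) ^ 3 * δ :=
    mul_le_mul_of_nonneg_right (pow_le_pow_left₀ hδ.le hδ' 3) hδ.le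
  have h5 : δ ^ 4 = δ ^ 3 * δ := by ring
  linarith

/-- A power of two between `800 α/ε` and `1600 α/ε`, where `800 = 8 · 100`. -/
theorem exists_depth {α ε : ℝ} (hε : 0 < ε) (hα : 2 * ε ≤ α) :
    ∃ L : ℕ, (2 : ℝ) ^ L ≤ 1600 * (α / ε) ∧ 8 * α * (1 / 2) ^ L ≤ ε / 100 := by
  have hs : 2 ≤ α / ε := by rwa [le_div_iff₀ hε]
  obtain ⟨L, hL1, hL2⟩ := exists_nat_pow_near (x := 800 * (α / ε)) (y := (2 : ℝ)) (by linarith)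
    (by norm_num)
  refine ⟨L + 1, ?_, ?_⟩
  · rw [pow_succ]
    linarith
  · rw [one_div, inv_pow, ← div_eq_mul_inv, div_le_iff₀ (by positivity)]
    have h1 : 800 * (α / ε) * ε = 800 * α := by field_simp
    have h2 := mul_le_mul_of_nonneg_right hL2.le hε.le
    linarith

/-- About `5000 log (16(L + 1)J/δ)` shots are needed. With `q = β log (1/δ) / (δε)` one has `L + 1 ≤
2^L = O(α/ε)` and `J/δ = O(q²)`, so this is a sum of a constant, `log (α/ε)` and `log q`. Both
logarithms are bounded below, hence the sum is at most a multiple of their product. -/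
theorem exists_shotCount {α β ε δ : ℝ} (hε : 0 < ε) (hβ : ε ≤ β / 2) (hα : β ≤ α) (hδ : 0 < δ)
    (hδ' : δ ≤ 1 / 2) {J L : ℕ} (hJ0 : 0 < J)
    (hJ : (J : ℝ) ≤ 51201 * (β ^ 2 / ε ^ 2 * Real.log (1 / δ)))
    (hL : (2 : ℝ) ^ L ≤ 1600 * (α / ε)) :
    ∃ n : ℕ, (n : ℝ) ≤ 180002 * (Real.log (α / ε) *
        Real.log (β * Real.log (1 / δ) / (δ * ε))) ∧
      8 * (L + 1) * Real.exp (-(n / 5000)) ≤ δ / (2 * J) := by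
  have hβ0 : 0 < β := by linarith
  have hα0 : 0 < α := by linarith
  have hl2 := log_one_div_ge hδ hδ'
  have hr2 := four_le_sq_div_sq hε hβ
  generalize Real.log (1 / δ) = l at *
  have hδ2 : 2 ≤ 1 / δ := by
    rw [le_div_iff₀ hδ]
    linarith
  have hr : 2 ≤ β / ε := by
    rw [le_div_iff₀ hε]
    linarith
  have hs : 2 ≤ α / ε := by
    rw [le_div_iff₀ hε]
    linarith
  have hJ1 : (1 : ℝ) ≤ J := by exact_mod_cast hJ0
  have hLn : (0 : ℝ) ≤ L := Nat.cast_nonneg L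
  have hL1 : (L : ℝ) + 1 ≤ 2 ^ L := by exact_mod_cast (Nat.lt_two_pow_self : L < 2 ^ L)
  have ha1 : 69 / 100 ≤ Real.log (α / ε) := by
    have := Real.log_le_log (by norm_num) hs
    linarith [Real.log_two_gt_d9]
  have hqe : β * l / (δ * ε) = β / ε * l * (1 / δ) := by field_simp
  rw [hqe]
  have hl1 : 1 ≤ l * (1 / δ) := by
    have := mul_le_mul hl2 hδ2 (by norm_num) (by linarith)
    linarith
  have hq1 : 276 / 100 ≤ β / ε * l * (1 / δ) := by
    have h1 : 2 * (69 / 100) ≤ β / ε * l := mul_le_mul hr hl2 (by norm_num) (by linarith)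
    have h2 := mul_le_mul h1 hδ2 (by norm_num) (by linarith)
    linarith
  have hqsq : (β / ε * l * (1 / δ)) ^ 2 = β ^ 2 / ε ^ 2 * l * (1 / δ) * (l * (1 / δ)) := by
    rw [← div_pow]
    ring
  have hJδ : J / δ ≤ 51201 * (β / ε * l * (1 / δ)) ^ 2 := by
    have h0 : 0 ≤ β ^ 2 / ε ^ 2 * l * (1 / δ) := by positivity
    calc (J : ℝ) / δ = J * (1 / δ) := by ring
      _ ≤ 51201 * (β ^ 2 / ε ^ 2 * l) * (1 / δ) :=
          mul_le_mul_of_nonneg_right hJ (by linarith)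
      _ = 51201 * (β ^ 2 / ε ^ 2 * l * (1 / δ)) := by ring
      _ ≤ _ := by
          rw [hqsq]
          exact mul_le_mul_of_nonneg_left (le_mul_of_one_le_right h0 hl1) (by norm_num)
  generalize β / ε * l * (1 / δ) = q at hq1 hJδ ⊢
  have hb1 : 1 ≤ Real.log q := by
    rw [Real.le_log_iff_exp_le (by linarith)]
    linarith [Real.exp_one_lt_d9]
  have hq0 : 0 < q := by linarith
  have hy0 : 0 < 16 * ((L : ℝ) + 1) * J / δ := by positivity
  have hy1 : 1 ≤ 16 * ((L : ℝ) + 1) * J / δ := by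
    rw [one_le_div hδ]
    have := mul_nonneg hLn (zero_le_one.trans hJ1)
    linarith
  have hle : 16 * ((L : ℝ) + 1) * J / δ ≤ 2 ^ 31 * (α / ε) * q ^ 2 := by
    calc 16 * ((L : ℝ) + 1) * J / δ = 16 * ((L : ℝ) + 1) * (J / δ) := by ring
      _ ≤ 16 * (1600 * (α / ε)) * (51201 * q ^ 2) :=
          mul_le_mul (by linarith) hJδ (by positivity) (by positivity)
      _ = 1310745600 * (α / ε * q ^ 2) := by ring
      _ ≤ 2 ^ 31 * (α / ε * q ^ 2) := mul_le_mul_of_nonneg_right (by norm_num) (by positivity)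
      _ = _ := by ring
  have hlog : Real.log (16 * (L + 1) * J / δ) ≤
      31 * Real.log 2 + Real.log (α / ε) + 2 * Real.log q := by
    refine (Real.log_le_log hy0 hle).trans_eq ?_
    rw [Real.log_mul (by positivity) (by positivity), Real.log_mul (by positivity) (by positivity),
      Real.log_pow, Real.log_pow]
    push_cast
    ring
  have hlog0 := Real.log_nonneg hy1
  have h1 : Real.log (α / ε) ≤ Real.log (α / ε) * Real.log q :=
    le_mul_of_one_le_right (by linarith) hb1
  have h2 : 69 / 100 * Real.log q ≤ Real.log (α / ε) * Real.log q :=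
    mul_le_mul_of_nonneg_right ha1 (by linarith)
  refine ⟨⌈5000 * Real.log (16 * (L + 1) * J / δ)⌉₊, ?_, ?_⟩
  · have := Nat.ceil_lt_add_one (a := 5000 * Real.log (16 * (L + 1) * J / δ)) (by linarith)
    linarith [Real.log_two_lt_d9]
  · have h3 : Real.log (16 * (L + 1) * J / δ) ≤
        (⌈5000 * Real.log (16 * (L + 1) * J / δ)⌉₊ : ℝ) / 5000 := by
      rw [le_div_iff₀ (by norm_num), mul_comm]
      exact Nat.le_ceil _
    generalize ⌈5000 * Real.log (16 * (L + 1) * J / δ)⌉₊ = n at h3 ⊢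
    have h4 : Real.exp (-(n / 5000)) ≤ (16 * (L + 1) * J / δ)⁻¹ := by
      rw [Real.exp_neg]
      refine inv_anti₀ hy0 ?_
      rwa [← Real.log_le_iff_le_exp hy0]
    refine (mul_le_mul_of_nonneg_left h4 (by positivity)).trans_eq ?_
    field_simp
    norm_num

theorem exists_parameters {α β ε δ : ℝ} (hε : 0 < ε) (hβ : ε ≤ β / 2) (hα : β ≤ α) (hδ : 0 < δ)
    (hδ' : δ ≤ 1 / 2) :
    ∃ J L n : ℕ, 0 < J ∧ (J : ℝ) ≤ 10 ^ 11 * (β ^ 2 / ε ^ 2 * Real.log (1 / δ)) ∧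
      100 * ((n : ℝ) * 2 ^ L) ≤ 10 ^ 11 * (α / ε * Real.log (α / ε) *
        Real.log (β * Real.log (1 / δ) / (δ * ε))) ∧
      8 * α * (1 / 2) ^ L ≤ ε / 100 ∧
      8 * (L + 1) * Real.exp (-(n / 5000)) ≤ δ / (2 * J) ∧
      4 * Real.exp (-(J * (ε / 40) ^ 2 / (8 * β ^ 2))) ≤ δ / 2 := by
  obtain ⟨J, hJ0, hJ, htail⟩ := exists_sampleCount hε hβ hδ hδ'
  obtain ⟨L, hL, hacc⟩ := exists_depth hε (by linarith : 2 * ε ≤ α)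
  obtain ⟨n, hn, hfail⟩ := exists_shotCount hε hβ hα hδ hδ' hJ0 hJ hL
  refine ⟨J, L, n, hJ0, ?_, ?_, hacc, hfail, htail⟩
  · have h1 : (0 : ℝ) ≤ J := Nat.cast_nonneg J
    linarith
  · have h1 := mul_le_mul hn hL (by positivity) ((Nat.cast_nonneg n).trans hn)
    have h2 : (0 : ℝ) ≤ n * 2 ^ L := by positivity
    have e : 180002 * (Real.log (α / ε) * Real.log (β * Real.log (1 / δ) / (δ * ε))) *
        (1600 * (α / ε)) = 288003200 * (α / ε * Real.log (α / ε) *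
          Real.log (β * Real.log (1 / δ) / (δ * ε))) := by ring
    rw [e] at h1
    linarith

/-! ### Accuracy of the algorithm -/

section Accuracy

variable {N : ℕ}

theorem star_dotProduct_conj_mulVec (X O Y : Matrix (Fin N) (Fin N) ℂ) (x : Fin N → ℂ) :
    star x ⬝ᵥ ((Xᴴ * O * Y) *ᵥ x) = star (X *ᵥ x) ⬝ᵥ (O *ᵥ (Y *ᵥ x)) := by
  rw [Matrix.star_mulVec, ← Matrix.dotProduct_mulVec, Matrix.mulVec_mulVec, Matrix.mulVec_mulVec,
    mul_assoc]

theorem norm_toLp_mulVec_le (X : Matrix (Fin N) (Fin N) ℂ) (x : Fin N → ℂ) :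
    ‖(WithLp.toLp 2 (X *ᵥ x) : EuclideanSpace ℂ (Fin N))‖ ≤
      ‖X‖ * ‖(WithLp.toLp 2 x : EuclideanSpace ℂ (Fin N))‖ :=
  Matrix.l2_opNorm_mulVec X (WithLp.toLp 2 x)

theorem norm_unitary_le_one [NeZero N] (X : Matrix.unitaryGroup (Fin N) ℂ) :
    ‖(X : Matrix (Fin N) (Fin N) ℂ)‖ ≤ 1 :=
  (CStarRing.norm_of_mem_unitary X.2).le

theorem norm_toLp_prep_le_one [NeZero N] (X : Matrix.unitaryGroup (Fin N) ℂ) :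
    ‖(WithLp.toLp 2 ((X : Matrix (Fin N) (Fin N) ℂ) *ᵥ Pi.single 0 1) :
      EuclideanSpace ℂ (Fin N))‖ ≤ 1 := by
  refine (norm_toLp_mulVec_le _ _).trans ?_
  have h : ‖(WithLp.toLp 2 (Pi.single 0 1) : EuclideanSpace ℂ (Fin N))‖ = 1 :=
    (PiLp.norm_single 2 (fun _ : Fin N => ℂ) 0 1).trans norm_one
  rw [h, mul_one]
  exact norm_unitary_le_one X

theorem abs_coeffNorm_sub_one_le {K Λ T : ℝ} {M : ℕ} (hK : 2 ≤ K) (hΛT : 0 ≤ Λ * T)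
    (hM : (1 + Λ * T) * K ^ 2 ≤ M) : |coeffNorm K M - 1| ≤ 5 / K := by
  have hK0 : 0 < K := by linarith
  have hMK : K ^ 2 ≤ M := by
    have := mul_nonneg hΛT (sq_nonneg K)
    linarith
  have hM0 : (0 : ℝ) < M := lt_of_lt_of_le (by positivity) hMK
  rw [coeffNorm_eq_sum hK0]
  refine (abs_sum_coeff_sub_one_le hK0 (by nlinarith)).trans ?_
  have h1 : 2 * K / M ≤ 2 / K := by
    rw [div_le_div_iff₀ hM0 hK0]
    linarith
  have e : 5 / K = 2 * (2 / K) + 1 / K := by ring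
  rw [e]
  linarith

end Accuracy

end LCHS

end

open LCHS

theorem mainTheorem7 :
    ∃ C cHS : ℝ, 0 < C ∧ 0 < cHS ∧
      ∀ (N m : ℕ) [NeZero N] (α normO ε δ : ℝ),
        0 < ε → ε ≤ normO / 2 → normO ≤ α → 0 < δ → δ ≤ 1 / 2 →
        ∃ (J : ℕ) (P : LCHS.Estimator m N),
          (J : ℝ) ≤ C * (normO ^ 2 / ε ^ 2 * Real.log (1 / δ)) ∧
          (P.queries : ℝ) ≤ C * (α / ε * Real.log (α / ε) *
            Real.log (normO * Real.log (1 / δ) / (δ * ε))) ∧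
          ∀ (T t Λ : ℝ) (A : ℝ → Matrix (Fin N) (Fin N) ℂ) (u : ℝ → Fin N → ℂ)
            (O : Matrix (Fin N) (Fin N) ℂ) (K : ℝ) (M : ℕ)
            (U : Fin (M + 1) → ℝ → Matrix (Fin N) (Fin N) ℂ)
            (prep : Matrix.unitaryGroup (Fin N) ℂ)
            (obs : Matrix.unitaryGroup (LCHS.OracleBasis m N) ℂ)
            (W : Fin (M + 1) → Matrix.unitaryGroup (Fin N) ℂ),
            t ∈ Set.Icc 0 T →
            ContinuousOn A (Set.Icc 0 T) →
            (∀ s ∈ Set.Icc 0 T, (LCHS.hermPart (A s)).PosSemidef) →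
            (∀ s ∈ Set.Icc 0 T, ‖LCHS.hermPart (A s)‖ ≤ Λ) →
            LCHS.IsSolution T A u →
            ‖O‖ = normO →
            C * (normO / ε) ≤ K →
            C * ((1 + Λ * T) * K ^ 2) ≤ M →
            (∀ j, LCHS.IsPropagator T A (LCHS.node K M j) (U j)) →
            (prep : Matrix (Fin N) (Fin N) ℂ) *ᵥ Pi.single 0 1 = u 0 →
            LCHS.IsBlockEncoding α O obs →
            (∀ j, ‖(W j : Matrix (Fin N) (Fin N) ℂ) - U j t‖ ≤ cHS * (ε / normO)) →
            (∀ k k', 1 - δ / J ≤ LCHS.eventProb (P.prob (LCHS.pairOracles prep obs W k k'))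
              {z | ‖P.post z - star (u 0) ⬝ᵥ (((U k t)ᴴ * O * U k' t) *ᵥ u 0)‖ ≤ ε}) ∧
            1 - δ ≤ LCHS.eventProb (LCHS.samplesProb P K M prep obs W J)
              {ω | ‖LCHS.output P K M J ω - star (u t) ⬝ᵥ (O *ᵥ u t)‖ ≤ ε} := by
  -- The query count needs `100 · 180002 · 1600 < 10^11`; the same constant makes every `O(1/K)`
  -- error negligible against `ε / ‖O‖`.
  refine ⟨10 ^ 11, 1 / 100, by norm_num, by norm_num, ?_⟩
  intro N m _ α β ε δ hε hβ hα hδ hδ'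
  obtain ⟨J, L, n, hJ0, hJ, hq, hacc, hfail, htail⟩ := exists_parameters hε hβ hα hδ hδ'
  have hβ0 : 0 < β := by linarith
  have hα0 : 0 < α := by linarith
  refine ⟨J, amplitudeEstimator m N α L n, hJ, le_trans ?_ hq, ?_⟩
  · exact_mod_cast amplitudeEstimator_queries_le m N α L n
  intro T t Λ A u O K M U prep obs W ht hA hL hΛ hu hO hKC hMC hU hprep hobs hW
  set r := ε / β with hr
  have hr0 : 0 < r := by positivity
  have hr1 : r ≤ 1 / 2 := by
    rw [hr, div_le_iff₀ hβ0]
    linarith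
  have hβr : β * r = ε := by
    rw [hr]
    field_simp
  have hKr : 10 ^ 11 ≤ K * r := by
    have h1 := mul_le_mul_of_nonneg_right hKC hr0.le
    have e : 10 ^ 11 * (β / ε) * r = 10 ^ 11 := by
      rw [hr]
      field_simp
    linarith
  have hK : 10 ^ 11 ≤ K := by
    by_contra hcon
    push Not at hcon
    nlinarith
  have hK0 : 0 < K := by linarith
  have hinvK : ∀ c : ℝ, 0 ≤ c → c / K ≤ c * r / 10 ^ 11 := fun c hc => by
    rw [div_le_div_iff₀ hK0 (by norm_num)]
    nlinarith
  have hT : 0 ≤ T := ht.1.trans ht.2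
  have hΛ0 : 0 ≤ Λ := (norm_nonneg _).trans (hΛ 0 ⟨le_rfl, hT⟩)
  have hΛT : 0 ≤ Λ * T := mul_nonneg hΛ0 hT
  have hM : (1 + Λ * T) * K ^ 2 ≤ M := by
    have : 0 ≤ (1 + Λ * T) * K ^ 2 := by positivity
    linarith
  have hc1 := abs_coeffNorm_sub_one_le (by linarith) hΛT hM
  have hc5 := hinvK 5 (by norm_num)
  rw [abs_le] at hc1
  have hcpos : 0 < coeffNorm K M := by linarith
  have hcle : coeffNorm K M ≤ 2 := by linarith
  -- vectors
  have hu0 : ‖(WithLp.toLp 2 (u 0) : EuclideanSpace ℂ (Fin N))‖ ≤ 1 := by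
    rw [← hprep]
    exact norm_toLp_prep_le_one prep
  set B := Matrix.toEuclideanCLM (n := Fin N) (𝕜 := ℂ) O with hB
  have hBβ : ‖B‖ ≤ β := by
    rw [hB, Matrix.l2_opNorm_toEuclideanCLM, hO]
  set v : Fin (M + 1) → EuclideanSpace ℂ (Fin N) := fun j =>
    WithLp.toLp 2 ((W j : Matrix (Fin N) (Fin N) ℂ) *ᵥ u 0) with hv
  set w : Fin (M + 1) → EuclideanSpace ℂ (Fin N) := fun j =>
    WithLp.toLp 2 (U j t *ᵥ u 0) with hw
  set y : EuclideanSpace ℂ (Fin N) := WithLp.toLp 2 (u t) with hy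
  have hv1 : ∀ j, ‖v j‖ ≤ 1 := fun j => by
    refine (norm_toLp_mulVec_le _ _).trans ?_
    have := mul_le_mul (norm_unitary_le_one (W j)) hu0 (norm_nonneg _) zero_le_one
    linarith
  have hvw : ∀ j, ‖v j - w j‖ ≤ r / 100 := fun j => by
    have e : v j - w j = WithLp.toLp 2 (((W j : Matrix (Fin N) (Fin N) ℂ) - U j t) *ᵥ u 0) := by
      rw [Matrix.sub_mulVec, WithLp.toLp_sub]
    rw [e]
    refine (norm_toLp_mulVec_le _ _).trans ?_
    have := mul_le_mul (hW j) hu0 (norm_nonneg _) (by positivity)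
    linarith
  -- Nearness to a unitary evolution suffices here; unitarity of the propagator is not proved.
  have hwn : ∀ j, ‖w j‖ ≤ 2 := fun j => by
    have := norm_sub_le (v j) (v j - w j)
    rw [sub_sub_cancel] at this
    linarith [hv1 j, hvw j]
  have hwy : ‖∑ j, coeff K M j • w j - y‖ ≤ 34 / K :=
    norm_sum_coeff_smul_propagator_sub_le ht hA hL hΛ hu (by linarith) hM hU hu0
  set x := ∑ j, coeff K M j • v j with hx
  have hcsum : ∑ j, coeff K M j = coeffNorm K M := (coeffNorm_eq_sum hK0 M).symm
  have hcn : ∀ j, ‖coeff K M j‖ = coeff K M j := fun j =>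
    Real.norm_of_nonneg (coeff_nonneg hK0 M j)
  have hxn : ‖x‖ ≤ 2 := by
    refine (norm_sum_le_of_le _ fun j _ => ?_).trans (hcsum.le.trans hcle)
    rw [norm_smul, hcn]
    exact mul_le_of_le_one_right (coeff_nonneg hK0 M j) (hv1 j)
  have hxw : ‖x - ∑ j, coeff K M j • w j‖ ≤ 2 * (r / 100) := by
    rw [hx, ← Finset.sum_sub_distrib]
    refine (norm_sum_le_of_le (f := fun j => coeff K M j • v j - coeff K M j • w j) _
      (fun j _ => (?_ : _ ≤ coeff K M j * (r / 100)))).trans ?_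
    · rw [← smul_sub, norm_smul, hcn]
      exact mul_le_mul_of_nonneg_left (hvw j) (coeff_nonneg hK0 M j)
    · rw [← Finset.sum_mul, hcsum]
      exact mul_le_mul_of_nonneg_right hcle (by positivity)
  have hxy : ‖x - y‖ ≤ 21 / 1000 * r := by
    have h1 := norm_sub_le_norm_sub_add_norm_sub x (∑ j, coeff K M j • w j) y
    have h2 := hinvK 34 (by norm_num)
    linarith
  have hyn : ‖y‖ ≤ 3 := by
    have := norm_sub_le x (x - y)
    rw [sub_sub_cancel] at this
    linarith
  -- the amplitudes
  have hform : ∀ a b : Fin N → ℂ, star a ⬝ᵥ (O *ᵥ b) =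
      inner ℂ (WithLp.toLp 2 a) (B (WithLp.toLp 2 b)) := fun a b =>
    (inner_toEuclideanCLM_apply O a b).symm
  have hamp : ∀ k k', α * overlapOp (pairOracles prep obs W k k') (fun _ => false, 0)
      (fun _ => false, 0) = inner ℂ (v k) (B (v k')) := fun k k' => by
    rw [overlapOp_apply_zero hα0.ne' _ hobs]
    simp only [pairOracles]
    rw [hprep, star_dotProduct_conj_mulVec, hform]
  -- Half of the allowed failure probability is kept for the Hoeffding tail in the second
  -- conclusion.
  have hspec : ∀ k k', 1 - δ / (2 * J) ≤
      eventProb ((amplitudeEstimator m N α L n).prob (pairOracles prep obs W k k'))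
        {z | ‖(amplitudeEstimator m N α L n).post z - inner ℂ (v k) (B (v k'))‖ ≤
          ε / 100} := fun k k' => by
    have h1 := amplitudeEstimator_spec hα0.le L n (pairOracles prep obs W k k')
    rw [hamp] at h1
    refine le_trans (by linarith) (h1.trans (eventProb_mono
      ((amplitudeEstimator m N α L n).prob_isProbWeight _) fun z hz => ?_))
    exact le_trans hz hacc
  have hJr : (0 : ℝ) < J := by exact_mod_cast hJ0
  constructor
  · intro k k'
    have hle : δ / (2 * J) ≤ δ / J := by
      gcongr
      linarith
    refine le_trans (by linarith) ((hspec k k').trans (eventProb_mono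
      ((amplitudeEstimator m N α L n).prob_isProbWeight _) fun z hz => ?_))
    simp only [Set.mem_ofPred_eq] at hz ⊢
    rw [star_dotProduct_conj_mulVec, hform]
    have h1 := norm_inner_apply_sub_le hBβ (v k) (v k') (w k) (w k')
    have h2 : ‖v k - w k‖ * ‖v k'‖ + ‖w k‖ * ‖v k' - w k'‖ ≤
        r / 100 * 1 + 2 * (r / 100) :=
      add_le_add (mul_le_mul (hvw k) (hv1 k') (norm_nonneg _) (by positivity))
        (mul_le_mul (hwn k) (hvw k') (norm_nonneg _) (by norm_num))
    have h3 := mul_le_mul_of_nonneg_left h2 hβ0.le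
    have h4 := norm_sub_le_norm_sub_add_norm_sub ((amplitudeEstimator m N α L n).post z)
      (inner ℂ (v k) (B (v k'))) (inner ℂ (w k) (B (w k')))
    -- Replacing the black-box evolutions by the exact ones costs `3ε/100`, on top of the estimation
    -- error `ε/100`.
    have e : β * (r / 100 * 1 + 2 * (r / 100)) = 3 / 100 * ε := by
      rw [← hβr]
      ring
    linarith
  · set P := amplitudeEstimator m N α L n with hP
    have hsw : IsProbWeight (sampleProb P K M prep obs W) := sampleProb_isProbWeight hK0 hcpos
    have hZ : ∀ s : Sample P M, ‖inner ℂ (v s.1.1) (B (v s.1.2))‖ ≤ β := fun s => by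
      refine (norm_inner_le_norm _ _).trans ?_
      have h1 := B.le_of_opNorm_le hBβ (v s.1.2)
      have h2 : β * ‖v s.1.2‖ ≤ β * 1 := mul_le_mul_of_nonneg_left (hv1 _) hβ0.le
      have h3 := mul_le_mul (hv1 s.1.1) (h1.trans h2) (norm_nonneg _) zero_le_one
      linarith
    have hY : 1 - δ / (2 * J) ≤ eventProb (sampleProb P K M prep obs W)
        {s | ‖P.post s.2 - inner ℂ (v s.1.1) (B (v s.1.2))‖ ≤ ε / 100} :=
      le_eventProb_sampleProb hK0 hcpos hspec
    have hmc := eventProb_mean_sub_le hsw (Y := fun s => P.post s.2) hβ0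
      (by positivity : 0 < ε / 40) hZ hY hJ0
    rw [sum_sampleProb_mul fun k k' => inner ℂ (v k) (B (v k')),
      sum_sum_mul_inner_eq B (coeff K M) v, ← hx] at hmc
    have hγ : J * (δ / (2 * J)) = δ / 2 := by field_simp
    refine le_trans (by linarith) (hmc.trans (eventProb_mono
      (IsProbWeight.pi fun _ => hsw) fun ω hω => ?_))
    simp only [Set.mem_ofPred_eq] at hω ⊢
    rw [hform, output]
    have hcc : ((coeffNorm K M : ℝ) : ℂ) ≠ 0 := by exact_mod_cast hcpos.ne'
    -- Statistical error plus bias: at most `4(1/100 + 1/20) ε = 0.24 ε` and `0.105 ε`.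
    have e1 : (coeffNorm K M : ℂ) ^ 2 * ((∑ j, P.post (ω j).2) / (J : ℂ)) - inner ℂ y (B y) =
        (coeffNorm K M : ℂ) ^ 2 * ((∑ j, P.post (ω j).2) / (J : ℂ) -
          inner ℂ x (B x) / (coeffNorm K M : ℂ) ^ 2) +
        (inner ℂ x (B x) - inner ℂ y (B y)) := by
      field_simp
      ring
    have h1 : ‖(coeffNorm K M : ℂ) ^ 2 * ((∑ j, P.post (ω j).2) / (J : ℂ) -
        inner ℂ x (B x) / (coeffNorm K M : ℂ) ^ 2)‖ ≤ 4 * (ε / 100 + 2 * (ε / 40)) := by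
      rw [norm_mul, norm_pow, Complex.norm_real, Real.norm_of_nonneg hcpos.le]
      exact mul_le_mul ((pow_le_pow_left₀ hcpos.le hcle 2).trans_eq (by norm_num)) hω
        (norm_nonneg _) (by norm_num)
    have h2 := norm_inner_apply_sub_le hBβ x x y y
    have h3 : ‖x - y‖ * ‖x‖ + ‖y‖ * ‖x - y‖ ≤ 21 / 1000 * r * 2 + 3 * (21 / 1000 * r) :=
      add_le_add (mul_le_mul hxy hxn (norm_nonneg _) (by positivity))
        (mul_le_mul hyn hxy (norm_nonneg _) (by norm_num))
    have h4 := mul_le_mul_of_nonneg_left h3 hβ0.le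
    have e2 : β * (21 / 1000 * r * 2 + 3 * (21 / 1000 * r)) = 105 / 1000 * ε := by
      rw [← hβr]
      ring
    rw [e1]
    refine (norm_add_le _ _).trans ?_
    linarith
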